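/- Let $n,d,g,M$ be positive integer parameters (sequence length, feature dimension, polynomial degree, fast memory capacity), and let $r=\binom{d+g}{g}$. Consider Approximate Attention (the polynomial method of Alman and Song): given $Q,K,V\in\mathbb R^{n\times d}$, each row of $U_1\in\mathbb R^{n\times r}$ (of $U_2\in\mathbb R^{n\times r}$) consists of the $r$ monomials of degree at most $g$, up to constant coefficients, in the $d$ entries of the corresponding row of $Q$ (of $K$), and the output is $D^{-1}\,(U_1(U_2^\top V))$ with $D=\mathrm{diag}(U_1(U_2^\top \mathbf 1))$. All matrix products are computed by the standard inner-product method, i.e. the computational DAG has a node for each input entry, each entry of $U_1$ and $U_2$, each scalar product of two entries, each inner product (a single aggregation node), and each output entry. The optimal I/O complexity is the minimal total number of load and save steps of a red-blue pebbling of this DAG with fast memory capacity $M$, where values may be recomputed, and where a node may be computed incrementally, aggregating one operand at a time, so that partially aggregated values may be kept in fast memory, saved and loaded. Suppose that, asymptotically along a family of parameters, we are in Case III, that is, $M=o(d\cdot r)$, $g=\Omega(\log M)$ and $g=o(\sqrt M)$, and that moreover $d=O(g^{2-\delta_1})$ and $M=O(g^{\delta_2})$ for some constants $\delta_1,\delta_2>0$.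 Then the optimal I/O complexity of Approximate Attention is $$O\!\left(\frac{n\cdot r\cdot d\cdot g}{M}\right).$$ -/

import Mathlib

open Asymptotics Filter
open scoped ENNReal

/-! ### Red-blue pebbling with partial computations -/

/-- A computational DAG: `parents v` is the set of in-neighbours of `v`, that is, of the operands of
the operation `v`. -/
structure CompDAG (V : Type*) where
  parents : V → Finset V
  acyclic : WellFounded (fun u v : V => u ∈ parents v)

namespace CompDAG

variable {V : Type*}

/-- Nodes without in-edges: the inputs (and constants) of the computation. -/
def IsSource (G : CompDAG V) (v : V) : Prop := G.parents v = ∅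

/-- Nodes without out-edges: the outputs of the computation. -/
def IsSink (G : CompDAG V) (v : V) : Prop := ∀ w, v ∉ G.parents w

end CompDAG

/-- A configuration of the game. `red` is the set of nodes whose current value is in fast memory,
`blue` the set of nodes whose current value is in slow memory, and `marked v` is the set of those
parents of `v` that are already aggregated into the current (possibly partial) value of `v`. -/
structure PebbleState (V : Type*) where
  red : Finset V
  blue : Set V
  marked : V → Finset V

/-- The value of `v` is fully computed when all in-edges of `v` are marked. -/
def CompDAG.Complete {V : Type*} (G : CompDAG V) (s : PebbleState V) (v : V) : Prop :=
  s.marked v = G.parents v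

/-- Initially exactly the sources have a (blue) pebble and nothing has been computed. -/
def CompDAG.initialState {V : Type*} (G : CompDAG V) : PebbleState V where
  red := ∅
  blue := {v | G.IsSource v}
  marked := fun _ => ∅

/-- The game is finished when the fully computed values of all sinks are in slow memory. -/
def CompDAG.IsFinal {V : Type*} (G : CompDAG V) (s : PebbleState V) : Prop :=
  ∀ v, G.IsSink v → v ∈ s.blue ∧ G.Complete s v

/-- `Step G s s' c`: a single step leads from `s` to `s'` and has I/O cost `c`. -/
inductive CompDAG.Step {V : Type*} [DecidableEq V] (G : CompDAG V) :
    PebbleState V → PebbleState V → ℕ → Prop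
  /-- Load a (possibly partial) value from slow memory. -/
  | load (s : PebbleState V) (v : V) (hv : v ∈ s.blue) :
      Step G s { s with red := insert v s.red } 1
  /-- Save a (possibly partial) value to slow memory. -/
  | save (s : PebbleState V) (v : V) (hv : v ∈ s.red) :
      Step G s { s with blue := insert v s.blue } 1
  /-- Aggregate a fully computed value `u` in fast memory into its child `v`, where either the
  current value of `v` is in fast memory too, or `v` has no value yet. Any copy of the old value of
  `v` in slow memory is now out of date. -/
  | compute (s : PebbleState V) (u v : V) (huv : u ∈ G.parents v) (hu : u ∈ s.red)
      (hcomplete : G.Complete s u) (hnew : u ∉ s.marked v) (hv : v ∈ s.red ∨ v ∉ s.blue) :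
      Step G s
        { red := insert v s.red
          blue := s.blue \ {v}
          marked := Function.update s.marked v (insert u (s.marked v)) } 0
  /-- Delete from fast memory a value that is also in slow memory. -/
  | evict (s : PebbleState V) (v : V) (hv : v ∈ s.blue) :
      Step G s { s with red := s.red.erase v } 0
  /-- Delete the value of a node altogether; it can only be recomputed from scratch. -/
  | discard (s : PebbleState V) (v : V) :
      Step G s
        { red := s.red.erase v
          blue := s.blue \ {v}
          marked := Function.update s.marked v ∅ } 0

/-- `Pebbling G M s s' c`: a finite sequence of steps leads from `s` to `s'`, has total I/O cost `c`,
and never has more than `M` values in fast memory. -/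
inductive CompDAG.Pebbling {V : Type*} [DecidableEq V] (G : CompDAG V) (M : ℕ) :
    PebbleState V → PebbleState V → ℕ → Prop
  | nil (s : PebbleState V) : Pebbling G M s s 0
  | cons {s s' s'' : PebbleState V} {c c' : ℕ} (hstep : G.Step s s' c) (hcap : s'.red.card ≤ M)
      (hrest : Pebbling G M s' s'' c') : Pebbling G M s s'' (c + c')

/-- The optimal I/O cost of a computation with fast memory capacity `M` (`⊤` if there is no
pebbling at all). -/
noncomputable def CompDAG.optimalCost {V : Type*} [DecidableEq V] (G : CompDAG V) (M : ℕ) : ℕ∞ :=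
  ⨅ (c : ℕ) (_ : ∃ s, G.Pebbling M G.initialState s c ∧ G.IsFinal s), (c : ℕ∞)

/-! ### The computational DAG of Approximate Attention -/

/-- The terms of a polynomial of degree `g` in `d` variables: exponent vectors of total degree at
most `g`. There are `(d + g).choose g` of them. -/
abbrev Term (d g : ℕ) : Type := {l : Fin d → Fin (g + 1) // ∑ c, (l c : ℕ) ≤ g}

/-- The nodes of the computation `D⁻¹ (U₁ (U₂ᵀ V))`, `D = diag (U₁ (U₂ᵀ 1))`. Both `H = U₂ᵀ V` and
`U₂ᵀ 1` are treated as `U₂ᵀ [V 1]`: the column index `some j` belongs to the column `j` of `V`, and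
`none` to the all-ones vector. -/
inductive AttnNode (n d g : ℕ) : Type
  /-- entries of the query matrix `Q` -/
  | q (i : Fin n) (c : Fin d)
  /-- entries of the key matrix `K` -/
  | k (i : Fin n) (c : Fin d)
  /-- entries of the value matrix `V` -/
  | v (i : Fin n) (j : Fin d)
  /-- entries of `U₁` -/
  | u₁ (i : Fin n) (t : Term d g)
  /-- entries of `U₂` -/
  | u₂ (i : Fin n) (t : Term d g)
  /-- products `U₂[i,t] * V[i,j]` -/
  | hprod (i : Fin n) (t : Term d g) (j : Fin d)
  /-- entries of `U₂ᵀ [V 1]` -/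
  | h (t : Term d g) (j : Option (Fin d))
  /-- products `U₁[i,t] * (U₂ᵀ [V 1])[t,j]` -/
  | oprod (i : Fin n) (t : Term d g) (j : Option (Fin d))
  /-- entries of `U₁ (U₂ᵀ [V 1])`; column `none` is the diagonal of `D` -/
  | o (i : Fin n) (j : Option (Fin d))
  /-- entries of the result `D⁻¹ (U₁ (U₂ᵀ V))` -/
  | out (i : Fin n) (j : Fin d)
  deriving DecidableEq

namespace AttnNode

variable {n d g : ℕ}

/-- The operands of each operation. The entry of `U₁` (of `U₂`) in row `i` and column `t` is a
constant multiple of the monomial `t` in the entries of row `i` of `Q` (of `K`), so its operands are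
those entries that occur in `t` with a positive exponent. -/
def parents : AttnNode n d g → Finset (AttnNode n d g)
  | q _ _ => ∅
  | k _ _ => ∅
  | v _ _ => ∅
  | u₁ i t => (Finset.univ.filter fun c => t.1 c ≠ 0).image (q i)
  | u₂ i t => (Finset.univ.filter fun c => t.1 c ≠ 0).image (k i)
  | hprod i t j => {u₂ i t, v i j}
  | h t (some j) => Finset.univ.image fun i => hprod i t j
  | h t none => Finset.univ.image fun i => u₂ i t
  | oprod i t j => {u₁ i t, h t j}
  | o i j => Finset.univ.image fun t => oprod i t j
  | out i j => {o i (some j), o i none}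

/-- A topological numbering of the layers. -/
def layer : AttnNode n d g → ℕ
  | q _ _ => 0
  | k _ _ => 0
  | v _ _ => 0
  | u₁ _ _ => 1
  | u₂ _ _ => 1
  | hprod _ _ _ => 2
  | h _ _ => 3
  | oprod _ _ _ => 4
  | o _ _ => 5
  | out _ _ => 6

theorem layer_lt_of_mem_parents (x y : AttnNode n d g) (hxy : x ∈ y.parents) :
    x.layer < y.layer := by
  cases y with
  | h t j => cases j <;> simp [parents] at hxy <;> obtain ⟨a, rfl⟩ := hxy <;> simp [layer]
  | hprod i t j => simp [parents] at hxy; rcases hxy with rfl | rfl <;> simp [layer]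
  | oprod i t j => simp [parents] at hxy; rcases hxy with rfl | rfl <;> simp [layer]
  | out i j => simp [parents] at hxy; rcases hxy with rfl | rfl <;> simp [layer]
  | o i j => simp [parents] at hxy; obtain ⟨a, ha, rfl⟩ := hxy; simp [layer]
  | u₁ i t => simp [parents] at hxy; obtain ⟨a, ha, rfl⟩ := hxy; simp [layer]
  | u₂ i t => simp [parents] at hxy; obtain ⟨a, ha, rfl⟩ := hxy; simp [layer]
  | q i c => simp [parents] at hxy
  | k i c => simp [parents] at hxy
  | v i c => simp [parents] at hxy

end AttnNode

/-- The computational DAG of Approximate Attention with sequence length `n`, feature dimension `d`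
and polynomial degree `g`. -/
def attentionDAG (n d g : ℕ) : CompDAG (AttnNode n d g) where
  parents := AttnNode.parents
  acyclic := Subrelation.wf (fun {x y} => AttnNode.layer_lt_of_mem_parents x y)
    (measure AttnNode.layer).wf

-- Choose a set `T` of monomials and a set `J` of columns, and keep the corresponding block of `U₂ᵀ
-- [V 1]` in fast memory. It is built by one pass over the rows of `K` and `V` and then used in one
-- pass over the rows of `Q`, which adds the contribution of the block to partial outputs in slow
-- memory. If the monomials of `T` only involve the variables in `S`, their values in one row need
-- at most `|S| + 1` loads, so the block costs `n (2|S| + 2 + 3|J|)` (`reaches_accumulate_block`).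
-- The entries of `U₁` and `U₂` are never saved: they are recomputed for each block.
--
-- Let `w = min d g`. Classes of at most `w` columns and at most `M / (4w)` monomials fit into fast
-- memory. If each class of monomials involves `O(w)` variables, a block costs `O(n w)`. There are
-- `O(d / w)` column classes, so with `O(r w / M)` classes of monomials the total is `O(n r d w /
-- M)` (`optimalCost_attentionDAG_le_of_key`).
--
-- It remains to partition the monomials. For `d ≤ g` any partition will do, as there are only `d`
-- variables. For `d > g` (`exists_key`), split the variables into blocks of between `g / k` and `2
-- (g / k)` variables, `k` being a constant. Of the blocks met by a monomial declare `k` free, and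
-- group monomials that meet the same blocks and agree outside the free ones. A group involves at
-- most `g` variables outside the free blocks and at most `2g` inside them. It has at least `(g / k)
-- ^ k` members, since one variable can be chosen independently in each free block; as `M` is
-- polynomial in `g`, this is at least `M` for a suitable `k`. So there are few groups, and cutting
-- them into pieces of size `M / (4g)` costs only a constant factor. Monomials meeting fewer than
-- `k` blocks yield at most `k d ^ k` further groups, which is negligible because `r ≥ 2 ^ g` while
-- `d` and `M` are polynomial in `g`.

attribute [ext] PebbleState

/-! ### Composite pebbling moves and their costs -/

namespace PebbleState

variable {V : Type*} [DecidableEq V]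

/-- The nodes of `Y` receive red pebbles and the partial values described by `m`; their copies in
slow memory are outdated. -/
def upd (s : PebbleState V) (Y : Finset V) (m : V → Finset V) : PebbleState V where
  red := s.red ∪ Y
  blue := s.blue \ Y
  marked := fun x => if x ∈ Y then m x else s.marked x

/-- The nodes of `Y` receive blue pebbles and the partial values described by `m`. -/
def store (s : PebbleState V) (Y : Finset V) (m : V → Finset V) : PebbleState V where
  red := s.red
  blue := s.blue ∪ Y
  marked := fun x => if x ∈ Y then m x else s.marked x

end PebbleState

namespace CompDAG

open PebbleState

variable {V : Type*} [DecidableEq V] (G : CompDAG V) (M : ℕ)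

/-- The complete values of the nodes of `X` are made available in fast memory. -/
def avail (s : PebbleState V) (X : Finset V) : PebbleState V where
  red := s.red ∪ X
  blue := s.blue
  marked := fun x => if x ∈ X then G.parents x else s.marked x

/-- The node `x` is as in the initial state. -/
def Clean (s : PebbleState V) (x : V) : Prop :=
  x ∉ s.red ∧ (x ∈ s.blue ↔ G.IsSource x) ∧ s.marked x = ∅

/-- The complete value of the node `x` is in fast memory. -/
def Ready (s : PebbleState V) (x : V) : Prop :=
  x ∈ s.red ∧ G.Complete s x

/-- There is a pebbling from `s` to `s'` of cost at most `c`. -/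
def Reaches (s s' : PebbleState V) (c : ℕ) : Prop := ∃ c' ≤ c, G.Pebbling M s s' c'

variable {G M} {s s' s'' : PebbleState V} {c c' : ℕ}

theorem Pebbling.trans (h : G.Pebbling M s s' c) (h' : G.Pebbling M s' s'' c') :
    G.Pebbling M s s'' (c + c') := by
  induction h with
  | nil s => simpa using h'
  | cons hstep hcap _ ih => rw [add_assoc]; exact .cons hstep hcap (ih h')

theorem Reaches.refl (s : PebbleState V) : G.Reaches M s s 0 := ⟨0, le_rfl, .nil s⟩

theorem Reaches.trans (h : G.Reaches M s s' c) (h' : G.Reaches M s' s'' c') :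
    G.Reaches M s s'' (c + c') := by
  obtain ⟨a, ha, h⟩ := h
  obtain ⟨b, hb, h'⟩ := h'
  exact ⟨a + b, by omega, h.trans h'⟩

theorem Reaches.mono (h : G.Reaches M s s' c) (hc : c ≤ c') : G.Reaches M s s' c' := by
  obtain ⟨a, ha, h⟩ := h
  exact ⟨a, ha.trans hc, h⟩

theorem Reaches.of_step (h : G.Step s s' c) (hcap : s'.red.card ≤ M) : G.Reaches M s s' c :=
  ⟨c + 0, le_rfl, .cons h hcap (.nil _)⟩

/-- A loop over a finite set, where `F D` is the state after the iterations for `D`. -/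
theorem Reaches.loop {α : Type*} [DecidableEq α] (F : Finset α → PebbleState V) (T : Finset α)
    (h : ∀ D ⊆ T, ∀ x ∈ T, x ∉ D → G.Reaches M (F D) (F (insert x D)) c) :
    G.Reaches M (F ∅) (F T) (T.card * c) := by
  suffices H : ∀ D ⊆ T, G.Reaches M (F ∅) (F D) (D.card * c) from H T subset_rfl
  intro D
  induction D using Finset.induction_on with
  | empty => intro _; simpa using Reaches.refl (F ∅)
  | insert x D hx ih =>
    intro hD
    rw [Finset.insert_subset_iff] at hD
    rw [Finset.card_insert_of_notMem hx, add_mul, one_mul]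
    exact (ih hD.2).trans (h D hD.2 x hD.1 hx)

omit [DecidableEq V] in
theorem not_mem_parents_self (v : V) : v ∉ G.parents v :=
  fun h => G.acyclic.asymmetric _ _ h h

omit [DecidableEq V] in
theorem not_mem_parents_of_mem_parents {v w : V} (h : w ∈ G.parents v) : v ∉ G.parents w :=
  fun h' => G.acyclic.asymmetric _ _ h h'

theorem Reaches.load {v : V} (hv : v ∈ s.blue) (hcap : s.red.card + 1 ≤ M) :
    G.Reaches M s { s with red := insert v s.red } 1 :=
  .of_step (.load s v hv) ((Finset.card_insert_le _ _).trans hcap)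

theorem Reaches.save {v : V} (hv : v ∈ s.red) (hcap : s.red.card ≤ M) :
    G.Reaches M s { s with blue := insert v s.blue } 1 :=
  .of_step (.save s v hv) hcap

theorem Reaches.evict {v : V} (hv : v ∈ s.blue) (hcap : s.red.card ≤ M) :
    G.Reaches M s { s with red := s.red.erase v } 0 :=
  .of_step (.evict s v hv) ((Finset.card_erase_le).trans hcap)

theorem Reaches.discard (v : V) (hcap : s.red.card ≤ M) :
    G.Reaches M s
      { red := s.red.erase v
        blue := s.blue \ {v}
        marked := Function.update s.marked v ∅ } 0 :=
  .of_step (.discard s v) ((Finset.card_erase_le).trans hcap)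

theorem Reaches.compute {u v : V} (huv : u ∈ G.parents v) (hu : G.Ready s u)
    (hnew : u ∉ s.marked v) (hv : v ∈ s.red ∨ v ∉ s.blue) (hcap : (s.red ∪ {v}).card ≤ M) :
    G.Reaches M s (s.upd {v} fun x => insert u (s.marked x)) 0 := by
  have hs : s.upd {v} (fun x => insert u (s.marked x)) =
      { red := insert v s.red
        blue := s.blue \ {v}
        marked := Function.update s.marked v (insert u (s.marked v)) } := by
    ext1
    · simp [upd]
    · simp [upd]
    · ext1 x
      by_cases hx : x = v
      · subst hx; simp [upd]
      · simp [upd, hx]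
  rw [hs]
  refine .of_step (.compute s u v huv hu.1 hu.2 hnew hv) ?_
  simpa [Finset.union_comm] using hcap

@[simp] theorem upd_empty (s : PebbleState V) (m : V → Finset V) : s.upd ∅ m = s := by
  ext1 <;> simp [upd]

@[simp] theorem store_empty (s : PebbleState V) (m : V → Finset V) : s.store ∅ m = s := by
  ext1 <;> simp [store]

theorem Ready.upd {Y : Finset V} {m : V → Finset V} {x : V} (h : G.Ready s x) (hx : x ∉ Y) :
    G.Ready (s.upd Y m) x := by
  simp_all [Ready, Complete, PebbleState.upd]

theorem Clean.upd {Y : Finset V} {m : V → Finset V} {x : V} (h : G.Clean s x) (hx : x ∉ Y) :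
    G.Clean (s.upd Y m) x := by
  simp_all [Clean, PebbleState.upd]

theorem Ready.store {Y : Finset V} {m : V → Finset V} {x : V} (h : G.Ready s x) (hx : x ∉ Y) :
    G.Ready (s.store Y m) x := by
  simp_all [Ready, Complete, PebbleState.store]

theorem Clean.store {Y : Finset V} {m : V → Finset V} {x : V} (h : G.Clean s x) (hx : x ∉ Y) :
    G.Clean (s.store Y m) x := by
  simp_all [Clean, PebbleState.store]

theorem Clean.avail {X : Finset V} {x : V} (h : G.Clean s x) (hx : x ∉ X) :
    G.Clean (G.avail s X) x := by
  simp_all [Clean, CompDAG.avail]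

theorem Ready.avail {X : Finset V} {x : V} (h : G.Ready s x) : G.Ready (G.avail s X) x := by
  obtain ⟨h₁, h₂⟩ := h
  by_cases hx : x ∈ X <;> simp_all [Ready, Complete, CompDAG.avail]

theorem ready_avail {X : Finset V} {x : V} (hx : x ∈ X) : G.Ready (G.avail s X) x := by
  simp_all [Ready, Complete, CompDAG.avail]

/-- Lets temporary values be forgotten after the update that used them: once `avail` is outermost,
`Reaches.release` applies. -/
theorem upd_avail {X Y : Finset V} {m : V → Finset V} (h : Disjoint X Y) :
    (G.avail s X).upd Y m = G.avail (s.upd Y m) X := by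
  rw [Finset.disjoint_left] at h
  ext1
  · simp only [avail, upd, Finset.union_right_comm]
  · simp [avail, upd]
  · ext1 x
    by_cases hx : x ∈ X
    · simp [avail, upd, hx, h hx]
    · simp [avail, upd, hx]

theorem store_avail {X Y : Finset V} {m : V → Finset V} (h : Disjoint X Y) :
    (G.avail s X).store Y m = G.avail (s.store Y m) X := by
  rw [Finset.disjoint_left] at h
  ext1
  · simp [avail, store]
  · simp [avail, store]
  · ext1 x
    by_cases hx : x ∈ X
    · simp [avail, store, hx, h hx]
    · simp [avail, store, hx]

/-- Aggregation is free once everything is in fast memory. The operands lie outside `Y`, so they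
stay complete while the nodes of `Y` change. -/
theorem Reaches.aggregate_map (Y : Finset V) (p : V → V) (hp : ∀ y ∈ Y, p y ∈ G.parents y)
    (hred : ∀ y ∈ Y, G.Ready s (p y)) (hnew : ∀ y ∈ Y, p y ∉ s.marked y)
    (hpY : ∀ y ∈ Y, p y ∉ Y) (hY : ∀ y ∈ Y, y ∈ s.red ∨ y ∉ s.blue)
    (hcap : (s.red ∪ Y).card ≤ M) :
    G.Reaches M s (s.upd Y fun y => insert (p y) (s.marked y)) 0 := by
  have := Reaches.loop (G := G) (M := M) (c := 0)
    (fun D => s.upd D fun y => insert (p y) (s.marked y)) Y ?_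
  · simpa using this
  intro D hD y hy hyD
  have := Reaches.compute (G := G) (M := M) (s := s.upd D fun y => insert (p y) (s.marked y))
    (hp y hy) ((hred y hy).upd fun h => hpY y hy (hD h)) (by simp [PebbleState.upd, hyD, hnew y hy])
    (by simpa [PebbleState.upd, hyD] using hY y hy)
    ((Finset.card_le_card (by
      simp only [PebbleState.upd]
      exact Finset.union_subset (Finset.union_subset_union_right hD)
        (by simp [hy]))).trans hcap)
  convert this using 1
  ext1
  · ext; simp [upd]
  · ext; simp [upd]; tauto
  · ext1 x
    by_cases hx : x = y
    · subst hx; simp [upd, hyD]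
    · simp [upd, hx]

/-- Ready operands are aggregated into `v`. -/
theorem Reaches.aggregate_set {v : V} {W : Finset V} (hW : W.Nonempty) (hWv : W ⊆ G.parents v)
    (hred : ∀ w ∈ W, G.Ready s w) (hnew : Disjoint W (s.marked v)) (hv : v ∈ s.red ∨ v ∉ s.blue)
    (hcap : (s.red ∪ {v}).card ≤ M) :
    G.Reaches M s (s.upd {v} fun x => s.marked x ∪ W) 0 := by
  induction hW using Finset.Nonempty.cons_induction with
  | singleton a =>
    simp only [Finset.singleton_subset_iff] at hWv
    simpa [Finset.union_comm] using Reaches.compute hWv (hred a (by simp)) (by simpa using hnew) hv hcap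
  | cons a W ha hW ih =>
    simp only [Finset.cons_eq_insert, Finset.insert_subset_iff, Finset.disjoint_insert_left,
      Finset.mem_insert, forall_eq_or_imp] at *
    have h1 := ih hWv.2 hred.2 hnew.2
    have hav : a ≠ v := by rintro rfl; exact not_mem_parents_self _ hWv.1
    have h2 := Reaches.compute (G := G) (M := M) (s := s.upd {v} fun x => s.marked x ∪ W) hWv.1
      (hred.1.upd (by simpa using hav)) (by simp [PebbleState.upd, hnew.1, ha])
      (by simp [PebbleState.upd]) (by simpa [PebbleState.upd] using hcap)
    convert h1.trans h2 using 1
    ext1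
    · simp [upd]
    · simp [upd]
    · ext1 x
      by_cases hx : x = v
      · subst hx; simp [upd]
      · simp [upd, hx]

theorem Reaches.avail_single {v : V} (hv : G.Clean s v) (hs : ¬ G.IsSource v)
    (hp : ∀ p ∈ G.parents v, G.Ready s p) (hcap : s.red.card + 1 ≤ M) :
    G.Reaches M s (G.avail s {v}) 0 := by
  obtain ⟨h1, h2, h3⟩ := hv
  have := Reaches.aggregate_set (G := G) (M := M) (Finset.nonempty_iff_ne_empty.2 hs) subset_rfl hp
    (by simp [h3]) (Or.inr (by simpa [h2] using hs))
    ((Finset.card_union_le _ _).trans (by simpa using hcap))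
  convert this using 1
  ext1
  · simp [avail, upd]
  · ext x; simp only [avail, upd, Set.mem_sdiff]
    constructor
    · intro hx; refine ⟨hx, ?_⟩; rintro hxv; simp at hxv; subst hxv; exact hs (h2.1 hx)
    · exact fun h => h.1
  · ext1 x
    by_cases hx : x = v
    · subst hx; simp [upd, avail, h3]
    · simp [upd, hx, avail]

/-- Temporary values disappear at no cost. Sources are evicted, since discarding them would also
destroy their only copy in slow memory; other nodes are discarded, which resets them to their
initial state. -/
theorem Reaches.release (X : Finset V) (hX : ∀ x ∈ X, G.Clean s x)
    (hcap : (s.red ∪ X).card ≤ M) : G.Reaches M (G.avail s X) s 0 := by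
  induction X using Finset.induction_on with
  | empty =>
    convert Reaches.refl s
    ext1 <;> simp [avail]
  | insert x X hx ih =>
    simp only [Finset.mem_insert, forall_eq_or_imp] at hX
    have hXc : (s.red ∪ X).card ≤ M := (Finset.card_le_card (by grind)).trans hcap
    refine Reaches.trans (c := 0) (c' := 0) ?_ (ih hX.2 hXc)
    obtain ⟨h1, h2, h3⟩ := hX.1
    by_cases hs : G.IsSource x
    · convert Reaches.evict (G := G) (M := M) (s := G.avail s (insert x X)) (v := x)
        (by simpa [CompDAG.avail, h2] using hs) hcap using 1
      ext1
      · ext y; by_cases hy : y = x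
        · subst hy; simp [avail, hx, h1]
        · simp [avail, hy]
      · simp [avail]
      · ext1 y; by_cases hy : y = x
        · subst hy; simp [avail, hx, h3, show G.parents y = ∅ from hs]
        · simp [avail, hy]
    · convert Reaches.discard (G := G) (M := M) (s := G.avail s (insert x X)) x hcap using 1
      ext1
      · ext y; by_cases hy : y = x
        · subst hy; simp [avail, hx, h1]
        · simp [avail, hy]
      · ext y; by_cases hy : y = x
        · subst hy; simp [avail, h2, hs]
        · simp [avail, hy]
      · ext1 y; by_cases hy : y = x
        · subst hy; simp [avail, hx, h3]
        · simp [avail, hy]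

theorem Reaches.avail_source {v : V} (hv : G.Clean s v) (hs : G.IsSource v)
    (hcap : s.red.card + 1 ≤ M) : G.Reaches M s (G.avail s {v}) 1 := by
  convert Reaches.load (G := G) (M := M) (hv.2.1.2 hs) hcap using 1
  ext1
  · simp [avail]
  · rfl
  · ext1 y; by_cases hy : y = v
    · subst hy; simp [avail, hv.2.2, show G.parents y = ∅ from hs]
    · simp [avail, hy]

/-- Operands that can be computed on the fly are aggregated, one into each node of `Y`. -/
theorem Reaches.aggregate_map_products (Y : Finset V) (w : V → V)
    (hw : ∀ y ∈ Y, w y ∈ G.parents y) (hclean : ∀ y ∈ Y, G.Clean s (w y))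
    (hsource : ∀ y ∈ Y, ¬ G.IsSource (w y))
    (hready : ∀ y ∈ Y, ∀ p ∈ G.parents (w y), G.Ready s p ∧ p ∉ Y)
    (hnew : ∀ y ∈ Y, w y ∉ s.marked y)
    (hwY : ∀ y ∈ Y, w y ∉ Y) (hY : ∀ y ∈ Y, y ∈ s.red ∨ y ∉ s.blue)
    (hcap : (s.red ∪ Y).card + 1 ≤ M) :
    G.Reaches M s (s.upd Y fun y => insert (w y) (s.marked y)) 0 := by
  have := Reaches.loop (G := G) (M := M) (c := 0)
    (fun D => s.upd D fun y => insert (w y) (s.marked y)) Y ?_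
  · simpa using this
  intro D hD y hy hyD
  set s₁ := s.upd D fun y => insert (w y) (s.marked y) with hs₁
  have hc1 : (s₁.red ∪ {y}).card + 1 ≤ M := by
    refine le_trans (Nat.succ_le_succ (Finset.card_le_card ?_)) hcap
    simp only [hs₁, PebbleState.upd]
    exact Finset.union_subset (Finset.union_subset_union_right hD) (by simp [hy])
  have hc0 : s₁.red.card + 1 ≤ M :=
    le_trans (Nat.succ_le_succ (Finset.card_le_card (Finset.subset_union_left))) hc1
  have hclean₁ : G.Clean s₁ (w y) := (hclean y hy).upd fun h => hwY y hy (hD h)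
  -- The operand is computed, consumed and released before the next one is needed, so a single spare
  -- slot serves all of `Y`.
  have h1 := Reaches.avail_single hclean₁ (hsource y hy)
    (fun p hp => (hready y hy p hp).1.upd fun h => (hready y hy p hp).2 (hD h)) hc0
  have hne : y ≠ w y := by intro h; exact hwY y hy (h ▸ hy)
  have h2 := Reaches.compute (G := G) (M := M) (s := G.avail s₁ {w y}) (hw y hy)
    (ready_avail (by simp)) (by simp [CompDAG.avail, hs₁, PebbleState.upd, hyD, hnew y hy, hne])
    (by simpa [CompDAG.avail, hs₁, PebbleState.upd, hyD, hne] using hY y hy)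
    (by
      refine le_trans ?_ hc1
      simp only [CompDAG.avail]
      rw [Finset.union_right_comm]
      exact Finset.card_union_le _ _)
  rw [upd_avail (by simpa using hne.symm)] at h2
  have h3 := Reaches.release (G := G) (M := M)
    (s := s₁.upd {y} fun x => insert (w y) ((G.avail s₁ {w y}).marked x)) {w y}
    (by simpa using hclean₁.upd (by simpa using hne.symm))
    ((Finset.card_union_le _ _).trans (by simpa [PebbleState.upd] using hc1))
  convert (h1.trans h2).trans h3 using 1
  ext1
  · ext; simp [upd, hs₁]
  · ext; simp [upd, hs₁]; tauto
  · ext1 x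
    by_cases hx : x = y
    · subst hx; simp [upd, avail, hs₁, hyD, hne]
    · simp [upd, hx, hs₁]

/-- Operands that can be computed on the fly are aggregated into `v`. -/
theorem Reaches.aggregate_products {v : V} {W : Finset V} (hW : W.Nonempty)
    (hWv : W ⊆ G.parents v) (hclean : ∀ w ∈ W, G.Clean s w ∧ ¬ G.IsSource w)
    (hready : ∀ w ∈ W, ∀ p ∈ G.parents w, G.Ready s p) (hnew : Disjoint W (s.marked v))
    (hv : v ∈ s.red ∨ v ∉ s.blue) (hcap : (s.red ∪ {v}).card + 1 ≤ M) :
    G.Reaches M s (s.upd {v} fun x => s.marked x ∪ W) 0 := by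
  have key : ∀ (s : PebbleState V) (a : V), a ∈ G.parents v → G.Clean s a → ¬ G.IsSource a →
      (∀ p ∈ G.parents a, G.Ready s p) → a ∉ s.marked v → (v ∈ s.red ∨ v ∉ s.blue) →
      (s.red ∪ {v}).card + 1 ≤ M →
      G.Reaches M s (s.upd {v} fun x => insert a (s.marked x)) 0 := by
    intro s a ha hc hs hr hn hv hcap
    refine Reaches.aggregate_map_products {v} (fun _ => a) ?_ ?_ ?_ ?_ ?_ ?_ ?_ hcap
    · simpa using ha
    · simpa using hc
    · simpa using hs
    · simp only [Finset.mem_singleton, forall_eq]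
      refine fun p hp => ⟨hr p hp, ?_⟩
      rintro rfl
      exact not_mem_parents_of_mem_parents ha hp
    · simpa using hn
    · simp only [Finset.mem_singleton, forall_eq]
      rintro rfl
      exact not_mem_parents_self _ ha
    · simpa using hv
  induction hW using Finset.Nonempty.cons_induction with
  | singleton a =>
    simp only [Finset.singleton_subset_iff, Finset.mem_singleton, forall_eq,
      Finset.disjoint_singleton_left] at hWv hclean hready hnew
    simpa [Finset.union_comm] using key s a hWv hclean.1 hclean.2 hready hnew hv hcap
  | cons a W ha hW ih =>
    simp only [Finset.cons_eq_insert, Finset.insert_subset_iff, Finset.disjoint_insert_left,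
      Finset.mem_insert, forall_eq_or_imp] at *
    have h1 := ih hWv.2 hclean.2 hready.2 hnew.2
    have hav : a ≠ v := by rintro rfl; exact not_mem_parents_self _ hWv.1
    have h2 := key (s.upd {v} fun x => s.marked x ∪ W) a hWv.1
      (hclean.1.1.upd (by simpa using hav)) hclean.1.2
      (fun p hp => (hready.1 p hp).upd (by
        rw [Finset.mem_singleton]
        rintro rfl
        exact not_mem_parents_of_mem_parents hWv.1 hp))
      (by simp [PebbleState.upd, hnew.1, ha])
      (by simp [PebbleState.upd]) (by simpa [PebbleState.upd] using hcap)
    convert h1.trans h2 using 1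
    ext1
    · simp [upd]
    · simp [upd]
    · ext1 x
      by_cases hx : x = v
      · subst hx; simp [upd]
      · simp [upd, hx]

/-- Partial values in slow memory are updated by operands that can be computed on the fly. -/
theorem Reaches.accumulate (Y : Finset V) (W : V → Finset V) (hY : ∀ v ∈ Y, v ∉ s.red)
    (hW : ∀ v ∈ Y, (W v).Nonempty)
    (hWv : ∀ v ∈ Y, W v ⊆ G.parents v) (hclean : ∀ v ∈ Y, ∀ w ∈ W v, G.Clean s w ∧ ¬ G.IsSource w)
    (hWY : ∀ v ∈ Y, ∀ w ∈ W v, w ∉ Y)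
    (hready : ∀ v ∈ Y, ∀ w ∈ W v, ∀ p ∈ G.parents w, G.Ready s p)
    (hnew : ∀ v ∈ Y, Disjoint (W v) (s.marked v))
    (hcap : s.red.card + 2 ≤ M) :
    G.Reaches M s (s.store Y fun x => s.marked x ∪ W x) (Y.card * 2) := by
  have := Reaches.loop (G := G) (M := M) (c := 2)
    (fun D => s.store D fun x => s.marked x ∪ W x) Y ?_
  · simpa using this
  intro D hD v hv hvD
  set s₁ := s.store D fun x => s.marked x ∪ W x with hs₁
  have hred₁ : s₁.red = s.red := rfl
  have hvr : v ∉ s₁.red := hY v hv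
  have hvm : s₁.marked v = s.marked v := by simp [hs₁, PebbleState.store, hvD]
  have hvne : ∀ w ∈ W v, w ≠ v := fun w hw h => not_mem_parents_self _ (h ▸ hWv v hv hw)
  -- Each node costs at most one load and one save. A node without a value in slow memory is started
  -- from scratch, with no load.
  obtain ⟨s₂, h2, hv2, hr2, hm2, hb2⟩ : ∃ s₂ : PebbleState V, G.Reaches M s₁ s₂ 1 ∧
      (v ∈ s₂.red ∨ v ∉ s₂.blue) ∧ s₂.red ∪ {v} = s₁.red ∪ {v} ∧ s₂.marked = s₁.marked ∧
      s₂.blue = s₁.blue := by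
    by_cases hb : v ∈ s₁.blue
    · exact ⟨_, Reaches.load hb (by rw [hred₁]; omega), Or.inl (by simp), by simp, rfl, rfl⟩
    · exact ⟨s₁, (Reaches.refl _).mono (by omega), Or.inr hb, rfl, rfl, rfl⟩
  have hr2' : ∀ x, x ≠ v → (x ∈ s₂.red ↔ x ∈ s₁.red) := by
    intro x hx
    have := congrArg (x ∈ ·) hr2
    simpa [hx] using this
  have hcl : ∀ w ∈ W v, G.Clean s₂ w ∧ ¬ G.IsSource w := by
    intro w hw
    have h := (hclean v hv w hw)
    have hh : G.Clean s₁ w := h.1.store fun hwD => hWY v hv w hw (hD hwD)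
    refine ⟨?_, h.2⟩
    simpa [Clean, hm2, hb2, hr2' w (hvne w hw)] using hh
  have hrd : ∀ w ∈ W v, ∀ p ∈ G.parents w, G.Ready s₂ p := by
    intro w hw p hp
    have h := hready v hv w hw p hp
    have hh : G.Ready s₁ p := h.store fun hpD => hY p (hD hpD) h.1
    have hpv : p ≠ v := by
      rintro rfl
      exact not_mem_parents_of_mem_parents (hWv _ hv hw) hp
    simpa [Ready, Complete, hm2, hr2' p hpv] using hh
  have hcap2 : (s₂.red ∪ {v}).card + 1 ≤ M := by
    rw [hr2, hred₁]
    have := Finset.card_union_le s.red {v}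
    simp only [Finset.card_singleton] at this
    omega
  have h3 := Reaches.aggregate_products (G := G) (M := M) (s := s₂) (hW v hv) (hWv v hv) hcl hrd
    (by rw [hm2, hvm]; exact hnew v hv) hv2 hcap2
  set s₃ := s₂.upd {v} fun x => s₂.marked x ∪ W v with hs₃
  have hcap3 : s₃.red.card ≤ M := by simp only [hs₃, PebbleState.upd]; omega
  have h4 := Reaches.save (G := G) (M := M) (s := s₃) (v := v)
    (by simp [hs₃, PebbleState.upd]) hcap3
  have h5 := Reaches.evict (G := G) (M := M) (s := { s₃ with blue := insert v s₃.blue }) (v := v)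
    (by simp) hcap3
  convert ((h2.trans h3).trans h4).trans h5 using 1
  ext1
  · simp only [hs₃, store, upd, hr2, hs₁]
    ext x; by_cases hx : x = v
    · subst hx; simp [hY _ hv]
    · simp [hx]
  · simp only [hs₃, store, upd, hb2, hs₁]
    ext x; by_cases hx : x = v
    · subst hx; simp
    · simp [hx]
  · ext1 x
    by_cases hx : x = v
    · subst hx; simp [upd, store, hs₃, hm2, hvm]
    · simp [upd, hx, hs₃, hs₁, store, hm2]

/-- Nodes whose operands are sources are computed by loading these sources one at a time. -/
theorem Reaches.build (X S : Finset V) (hX : ∀ x ∈ X, G.Clean s x) (hS : ∀ x ∈ S, G.Clean s x)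
    (hsource : ∀ x ∈ S, G.IsSource x) (hXS : Disjoint X S) (hp : ∀ x ∈ X, G.parents x ⊆ S)
    (hcap : (s.red ∪ X).card + 1 ≤ M) :
    G.Reaches M s (G.avail s X) (S.card + (X.filter fun x => G.parents x = ∅).card) := by
  -- The state after the sources in `D` have passed through fast memory: a node of `X` is present as
  -- soon as one of its operands has been seen. Each source feeds all its children in `X` and is
  -- then released, so one spare slot suffices.
  set F : Finset V → PebbleState V := fun D =>
    { red := s.red ∪ X.filter fun x => ¬ Disjoint (G.parents x) D
      blue := s.blue
      marked := fun x => if x ∈ X then G.parents x ∩ D else s.marked x } with hF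
  have hFred : ∀ D, (F D).red ⊆ s.red ∪ X := fun D =>
    Finset.union_subset_union_right (Finset.filter_subset _ _)
  have hXS' := Finset.disjoint_left.1 hXS
  have h0 : F ∅ = s := by
    ext1
    · simp [hF]
    · rfl
    · ext1 x
      by_cases hx : x ∈ X
      · simp [hF, hx, (hX x hx).2.2]
      · simp [hF, hx]
  have h1 : G.Reaches M (F ∅) (F S) (S.card * 1) := by
    refine Reaches.loop F S fun D hD c hc hcD => ?_
    have hcX : c ∉ X := fun h => hXS' h hc
    have hclean : G.Clean (F D) c := by
      obtain ⟨h1, h2, h3⟩ := hS c hc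
      exact ⟨by simp [hF, h1, hcX], h2, by simp [hF, hcX, h3]⟩
    have hcapD : (F D).red.card + 1 ≤ M :=
      le_trans (Nat.succ_le_succ (Finset.card_le_card (hFred D))) hcap
    have h1 := Reaches.avail_source hclean (hsource c hc) hcapD
    set Y := X.filter fun x => c ∈ G.parents x with hY
    have hYX : Y ⊆ X := Finset.filter_subset _ _
    have hcY : Disjoint {c} Y := by simpa using fun h => hcX (hYX h)
    have hcYr : ((F D).red ∪ Y).card + 1 ≤ M :=
      le_trans (Nat.succ_le_succ (Finset.card_le_card (Finset.union_subset (hFred D)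
        (hYX.trans Finset.subset_union_right)))) hcap
    have h2 := Reaches.aggregate_map (G := G) (M := M) (s := G.avail (F D) {c}) Y (fun _ => c)
      (by simp [hY]) (fun _ _ => ready_avail (by simp))
      (by
        intro y hy
        have hyc : y ≠ c := by rintro rfl; exact hcX (hYX hy)
        simp [CompDAG.avail, hF, hYX hy, hyc, hcD])
      (fun _ _ => by simpa using hcY)
      (by
        intro y hy
        right
        have hyX := hYX hy
        have : y ∉ s.blue := by
          rw [(hX y hyX).2.1]
          intro h
          have := (Finset.mem_filter.1 hy).2
          rw [show G.parents y = ∅ from h] at this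
          simp at this
        simpa [CompDAG.avail, hF] using this)
      (by
        refine le_trans ?_ hcYr
        simp only [CompDAG.avail]
        rw [Finset.union_right_comm]
        exact Finset.card_union_le _ _)
    rw [upd_avail hcY] at h2
    have h3 := Reaches.release (G := G) (M := M)
      (s := (F D).upd Y fun x => insert c ((G.avail (F D) {c}).marked x)) {c}
      (by simpa using hclean.upd (by simpa using hcY))
      ((Finset.card_union_le _ _).trans (by simpa [PebbleState.upd] using hcYr))
    convert (h1.trans h2).trans h3 using 1
    ext1
    · ext x
      simp only [hF, upd, hY, Finset.mem_union, Finset.mem_filter, Finset.disjoint_insert_right]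
      tauto
    · ext x
      simp only [hF, upd, Set.mem_sdiff, Finset.mem_coe, iff_self_and]
      intro hx hxY
      rw [(hX x (hYX hxY)).2.1] at hx
      have := (Finset.mem_filter.1 hxY).2
      rw [show G.parents x = ∅ from hx] at this
      simp at this
    · ext1 x
      by_cases hx : x ∈ X
      · have hxc : x ≠ c := by rintro rfl; exact hcX hx
        by_cases hxY : c ∈ G.parents x
        · simp [hF, upd, hY, hx, hxY, avail, hxc, Finset.inter_insert_of_mem]
        · simp [hF, upd, hY, hx, hxY, Finset.inter_insert_of_notMem]
      · simp [hF, upd, hY, hx]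
  -- Nodes without operands cannot be computed; being sources, they are loaded, one unit each.
  set X₀ := X.filter fun x => G.parents x = ∅ with hX₀
  have h2 := Reaches.loop (G := G) (M := M) (c := 1) (fun D => { F S with red := (F S).red ∪ D })
    X₀ (by
      intro D hD x hx hxD
      have hxX : x ∈ X ∧ G.parents x = ∅ := Finset.mem_filter.1 hx
      convert Reaches.load (G := G) (M := M) (s := { F S with red := (F S).red ∪ D }) (v := x) ?_ ?_
        using 1
      · ext1 <;> simp
      · exact (hX x hxX.1).2.1.2 hxX.2
      · refine le_trans (Nat.succ_le_succ (Finset.card_le_card ?_)) hcap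
        exact Finset.union_subset (hFred S)
          ((hD.trans (Finset.filter_subset _ _)).trans Finset.subset_union_right))
  rw [h0, mul_one] at h1
  simp only [Finset.union_empty, mul_one] at h2
  convert h1.trans h2 using 1
  ext1
  · ext x
    simp only [avail, hF, hX₀, Finset.mem_union, Finset.mem_filter]
    by_cases hx : x ∈ X
    · by_cases hpx : G.parents x = ∅
      · simp [hx, hpx]
      · have : ¬ Disjoint (G.parents x) S := by
          intro h
          exact hpx (Finset.disjoint_self_iff_empty _ |>.1 (h.mono_right (hp x hx)))
        simp [hx, this]
    · simp [hx]
  · rfl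
  · ext1 x
    by_cases hx : x ∈ X
    · simp [avail, hF, hx, Finset.inter_eq_left.2 (hp x hx)]
    · simp [avail, hF, hx]

theorem optimalCost_le (h : G.Reaches M G.initialState s c) (hs : G.IsFinal s) :
    G.optimalCost M ≤ c := by
  obtain ⟨c', hc', h⟩ := h
  refine (iInf₂_le c' ⟨s, h, hs⟩).trans ?_
  exact_mod_cast hc'

end CompDAG

/-! ### Computing a block of `U₂ᵀ [V 1]` and its contribution to the output -/

namespace CompDAG

open PebbleState

variable {V : Type*} [DecidableEq V]

theorem upd_upd_insert (s s' : PebbleState V) {D Y : Finset V} (w : V → V)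
    (hs' : ∀ y ∈ Y, s'.marked y = s.marked y) :
    (s.upd D fun y => insert (w y) (s.marked y)).upd Y (fun y => insert (w y) (s'.marked y)) =
      s.upd (D ∪ Y) fun y => insert (w y) (s.marked y) := by
  ext1
  · simp [upd]
  · simp [upd, Set.sdiff_sdiff]
  · ext1 x
    by_cases hx : x ∈ Y
    · simp [upd, hx, hs' x hx]
    · simp [upd, hx]

end CompDAG

namespace AttnNode

open CompDAG PebbleState

variable {n d g M : ℕ}

/-- The entries of `U₂ᵀ [V 1]` in the rows `T` and the columns `J`. -/
def hBlock (n : ℕ) (T : Finset (Term d g)) (J : Finset (Option (Fin d))) :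
    Finset (AttnNode n d g) :=
  (T ×ˢ J).image fun p => h p.1 p.2

/-- The entries of `U₁ (U₂ᵀ [V 1])` in the rows `I` and the columns `J`. -/
def oBlock (g : ℕ) (I : Finset (Fin n)) (J : Finset (Option (Fin d))) :
    Finset (AttnNode n d g) :=
  (I ×ˢ J).image fun p => o p.1 p.2

/-- The operand with which row `i` contributes to an entry of `U₂ᵀ [V 1]`. -/
def hOperand (i : Fin n) : AttnNode n d g → AttnNode n d g
  | h t (some j) => hprod i t j
  | h t none => u₂ i t
  | x => x

/-- The operands with which the terms `T` contribute to an entry of `U₁ (U₂ᵀ [V 1])`. -/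
def oOperands (T : Finset (Term d g)) : AttnNode n d g → Finset (AttnNode n d g)
  | o i j => T.image fun t => oprod i t j
  | _ => ∅

variable {T : Finset (Term d g)} {J : Finset (Option (Fin d))} {I : Finset (Fin n)}

theorem mem_hBlock {x : AttnNode n d g} : x ∈ hBlock n T J ↔ ∃ t ∈ T, ∃ j ∈ J, x = h t j := by
  simp only [hBlock, Finset.mem_image, Finset.mem_product, Prod.exists]
  grind

theorem mem_oBlock {x : AttnNode n d g} : x ∈ oBlock g I J ↔ ∃ i ∈ I, ∃ j ∈ J, x = o i j := by
  simp only [oBlock, Finset.mem_image, Finset.mem_product, Prod.exists]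
  grind

theorem layer_of_mem_hBlock {x : AttnNode n d g} (hx : x ∈ hBlock n T J) : x.layer = 3 := by
  obtain ⟨t, _, j, _, rfl⟩ := mem_hBlock.1 hx
  rfl

theorem layer_of_mem_oBlock {x : AttnNode n d g} (hx : x ∈ oBlock g I J) : x.layer = 5 := by
  obtain ⟨t, _, j, _, rfl⟩ := mem_oBlock.1 hx
  rfl

theorem card_hBlock_le : (hBlock n T J).card ≤ T.card * J.card :=
  Finset.card_image_le.trans (Finset.card_product _ _).le

theorem card_oBlock_le : (oBlock g I J).card ≤ I.card * J.card :=
  Finset.card_image_le.trans (Finset.card_product _ _).le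

theorem hBlock_insert (j : Option (Fin d)) :
    hBlock n T (insert j J) = hBlock n T J ∪ hBlock n T {j} := by
  ext x
  simp only [mem_hBlock, Finset.mem_union]
  grind

theorem oBlock_insert (i : Fin n) :
    oBlock g (insert i I) J = oBlock g I J ∪ oBlock g {i} J := by
  ext x
  simp only [mem_oBlock, Finset.mem_union]
  grind

theorem hBlock_empty : hBlock n T ∅ = ∅ := by simp [hBlock]

theorem oBlock_empty : oBlock (d := d) g (∅ : Finset (Fin n)) J = ∅ := by simp [oBlock]

theorem hBlock_mono {J' : Finset (Option (Fin d))} (hJ : J ⊆ J') :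
    hBlock n T J ⊆ hBlock n T J' :=
  Finset.image_subset_image (Finset.product_subset_product_right hJ)

theorem oBlock_mono {I' : Finset (Fin n)} (hI : I ⊆ I') :
    oBlock (d := d) g I J ⊆ oBlock g I' J :=
  Finset.image_subset_image (Finset.product_subset_product_left hI)

theorem disjoint_of_layer_ne {X Y : Finset (AttnNode n d g)}
    (hXY : ∀ x ∈ X, ∀ y ∈ Y, x.layer ≠ y.layer) : Disjoint X Y :=
  Finset.disjoint_left.2 fun x hx hx' => hXY x hx x hx' rfl

theorem parents_attentionDAG (x : AttnNode n d g) : (attentionDAG n d g).parents x = x.parents :=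
  rfl

theorem isSource_of_layer_eq_zero {x : AttnNode n d g} (hx : x.layer = 0) :
    (attentionDAG n d g).IsSource x := by
  cases x <;> simp [layer] at hx <;> rfl

theorem isSource_iff {x : AttnNode n d g} :
    (attentionDAG n d g).IsSource x ↔ x.parents = ∅ := Iff.rfl

theorem not_isSource_hprod (i : Fin n) (t : Term d g) (j : Fin d) :
    ¬ (attentionDAG n d g).IsSource (hprod i t j) := by
  simp [isSource_iff, parents]

theorem not_isSource_oprod (i : Fin n) (t : Term d g) (j : Option (Fin d)) :
    ¬ (attentionDAG n d g).IsSource (oprod i t j) := by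
  simp [isSource_iff, parents]

theorem parents_h (t : Term d g) (j : Option (Fin d)) :
    (h t j : AttnNode n d g).parents = Finset.univ.image fun i => hOperand i (h t j) := by
  cases j <;> rfl

theorem not_isSource_h (hn : 0 < n) (t : Term d g) (j : Option (Fin d)) :
    ¬ (attentionDAG n d g).IsSource (h t j) := by
  have : Nonempty (Fin n) := ⟨⟨0, hn⟩⟩
  rw [isSource_iff, parents_h, Finset.image_eq_empty, Finset.univ_eq_empty_iff]
  exact not_isEmpty_of_nonempty _

theorem hOperand_injective (y : AttnNode n d g) (hy : y.layer = 3) {i i' : Fin n}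
    (hii : hOperand i y = hOperand i' y) : i = i' := by
  cases y <;> simp [layer] at hy
  case h t j => cases j <;> simpa [hOperand] using hii

theorem layer_hOperand (y : AttnNode n d g) (hy : y.layer = 3) (i : Fin n) :
    (hOperand i y).layer ≤ 2 := by
  cases y <;> simp [layer] at hy
  case h t j => cases j <;> simp [hOperand, layer]

/-- Only the constant monomial has no operands. Its node is a source that must be loaded, whence the
`+ 1` in the cost of a row. -/
theorem card_constant_terms_le (f : Term d g → AttnNode n d g)
    (hf : ∀ t, (f t).parents = ∅ → ∀ c, t.1 c = 0) (T : Finset (Term d g)) :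
    ((T.image f).filter fun x => (attentionDAG n d g).parents x = ∅).card ≤ 1 := by
  rw [Finset.card_le_one]
  intro a ha b hb
  obtain ⟨ha', ha⟩ := Finset.mem_filter.1 ha
  obtain ⟨hb', hb⟩ := Finset.mem_filter.1 hb
  obtain ⟨t, _, rfl⟩ := Finset.mem_image.1 ha'
  obtain ⟨t', _, rfl⟩ := Finset.mem_image.1 hb'
  congr 1
  ext c
  rw [hf t ha c, hf t' hb c]

variable {s : PebbleState (AttnNode n d g)}

/-- Row `i` of `U₂` and `V` is aggregated into a block of `U₂ᵀ [V 1]` in fast memory. -/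
theorem reaches_aggregate_row (i : Fin n) (S : Finset (Fin d))
    (hS : ∀ t ∈ T, ∀ c, t.1 c ≠ 0 → c ∈ S)
    (hclean : ∀ x : AttnNode n d g, x.layer ≤ 2 → (attentionDAG n d g).Clean s x)
    (hh : ∀ y ∈ hBlock n T J, y ∈ s.red ∨ y ∉ s.blue)
    (hnew : ∀ y ∈ hBlock n T J, hOperand i y ∉ s.marked y)
    (hcap : (s.red ∪ hBlock n T J).card + T.card + 2 ≤ M) :
    (attentionDAG n d g).Reaches M s
      (s.upd (hBlock n T J) fun y => insert (hOperand i y) (s.marked y))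
      (S.card + 1 + J.card) := by
  set G := attentionDAG n d g with hG
  set U : Finset (AttnNode n d g) := T.image (u₂ i) with hU
  have hUl : ∀ x ∈ U, x.layer = 1 := by
    intro x hx
    obtain ⟨t, _, rfl⟩ := Finset.mem_image.1 hx
    rfl
  have hUc : U.card ≤ T.card := Finset.card_image_le
  have hsc : s.red.card + T.card + 2 ≤ M := by
    have := Finset.card_le_card (Finset.subset_union_left (s₁ := s.red) (s₂ := hBlock n T J))
    omega
  have hUcap : (s.red ∪ U).card + 1 ≤ M := by
    have := Finset.card_union_le s.red U
    omega
  have h1 : G.Reaches M s (G.avail s U) (S.card + 1) := by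
    refine (Reaches.build (G := G) (M := M) (s := s) U (S.image (k i))
      (fun x hx => hclean x (by rw [hUl x hx]; omega)) ?_ ?_ ?_ ?_ hUcap).mono ?_
    · intro x hx
      obtain ⟨c, _, rfl⟩ := Finset.mem_image.1 hx
      exact hclean _ (by simp [layer])
    · intro x hx
      obtain ⟨c, _, rfl⟩ := Finset.mem_image.1 hx
      exact isSource_of_layer_eq_zero rfl
    · refine disjoint_of_layer_ne fun x hx y hy => ?_
      obtain ⟨c, _, rfl⟩ := Finset.mem_image.1 hy
      rw [hUl x hx]
      simp [layer]
    · intro x hx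
      obtain ⟨t, ht, rfl⟩ := Finset.mem_image.1 hx
      exact Finset.image_subset_image fun c hc => hS t ht c (Finset.mem_filter.1 hc).2
    · refine add_le_add Finset.card_image_le (card_constant_terms_le _ ?_ T)
      intro t ht c
      simpa [parents] using Finset.filter_eq_empty_iff.1 (Finset.image_eq_empty.1 ht)
        (Finset.mem_univ c)
  have h2 := Reaches.loop (G := G) (M := M) (c := 1)
    (fun D => (G.avail s U).upd (hBlock n T D)
      fun y => insert (hOperand i y) ((G.avail s U).marked y)) J (by
    intro D hD j hj hjD
    set s₁ := G.avail s U with hs₁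
    set Y := hBlock n T {j} with hY
    have hYJ : Y ⊆ hBlock n T J := hBlock_mono (by simpa using hj)
    have hYl : ∀ y ∈ Y, y.layer = 3 := fun y hy => layer_of_mem_hBlock hy
    have hYm : ∀ y ∈ Y, s₁.marked y = s.marked y := by
      intro y hy
      have : y ∉ U := fun h => by have := hUl y h; rw [hYl y hy] at this; omega
      simp [hs₁, CompDAG.avail, this]
    have hdisj : Disjoint (hBlock n T D) Y := by
      rw [Finset.disjoint_left]
      intro x hx hx'
      obtain ⟨t, _, j', hj', rfl⟩ := mem_hBlock.1 hx
      obtain ⟨t', _, j'', hj'', h⟩ := mem_hBlock.1 hx'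
      simp only [AttnNode.h.injEq, Finset.mem_singleton] at h hj''
      exact hjD (hj'' ▸ h.2 ▸ hj')
    set s₂ := s₁.upd (hBlock n T D) fun y => insert (hOperand i y) (s₁.marked y) with hs₂
    have hYm₂ : ∀ y ∈ Y, s₂.marked y = s.marked y := by
      intro y hy
      rw [← hYm y hy]
      simp [hs₂, PebbleState.upd, Finset.disjoint_right.1 hdisj hy]
    have hclean₂ : ∀ x : AttnNode n d g, x.layer ≤ 2 → x.layer ≠ 1 → G.Clean s₂ x := by
      intro x hx hx1
      refine Clean.upd (Clean.avail (hclean x hx) fun h => hx1 (hUl x h)) fun h => ?_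
      have := layer_of_mem_hBlock h
      omega
    have hready₂ : ∀ t ∈ T, G.Ready s₂ (u₂ i t) := by
      intro t ht
      refine Ready.upd (ready_avail (Finset.mem_image_of_mem _ ht)) fun h => ?_
      have := layer_of_mem_hBlock h
      simp [layer] at this
    -- Besides the block and the row of `U₂`, two slots are needed: one for an entry of `V` and one
    -- for a product.
    have hcap₂ : (s₂.red ∪ Y).card + 2 ≤ M := by
      have h1 : s₂.red ∪ Y ⊆ (s.red ∪ hBlock n T J) ∪ U := by
        simp only [hs₂, hs₁, PebbleState.upd, CompDAG.avail]
        have := hBlock_mono (n := n) (T := T) hD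
        intro x
        simp only [Finset.mem_union]
        grind
      have h2 := Finset.card_le_card h1
      have h3 := Finset.card_union_le (s.red ∪ hBlock n T J) U
      omega
    have hYr : ∀ y ∈ Y, y ∈ s₂.red ∨ y ∉ s₂.blue := by
      intro y hy
      have := hh y (hYJ hy)
      simp only [hs₂, hs₁, PebbleState.upd, CompDAG.avail, Finset.mem_union, Set.mem_sdiff]
      tauto
    have hnew₂ : ∀ y ∈ Y, hOperand i y ∉ s₂.marked y := by
      intro y hy
      rw [hYm₂ y hy]
      exact hnew y (hYJ hy)
    have hpar : ∀ y ∈ Y, hOperand i y ∈ G.parents y := by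
      intro y hy
      obtain ⟨t, _, j', _, rfl⟩ := mem_hBlock.1 hy
      rw [hG, parents_attentionDAG, parents_h]
      exact Finset.mem_image_of_mem _ (Finset.mem_univ i)
    have hopY : ∀ y ∈ Y, hOperand i y ∉ Y := by
      intro y hy h
      have := layer_hOperand y (hYl y hy) i
      rw [hYl _ h] at this
      omega
    have hmerge : ∀ s' : PebbleState (AttnNode n d g), (∀ y ∈ Y, s'.marked y = s.marked y) →
        s₂.upd Y (fun y => insert (hOperand i y) (s'.marked y)) =
          s₁.upd (hBlock n T (insert j D)) fun y => insert (hOperand i y) (s₁.marked y) := by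
      intro s' hs'
      rw [hBlock_insert, hs₂]
      exact upd_upd_insert s₁ s' _ fun y hy => (hs' y hy).trans (hYm y hy).symm
    -- In the all-ones column the entries of `U₂` are themselves the operands, so nothing is loaded.
    -- In any other column one entry of `V` is loaded and serves all monomials of `T`.
    cases j with
    | none =>
      have h := Reaches.aggregate_map (G := G) (M := M) (s := s₂) Y (hOperand i) hpar
        (by
          intro y hy
          obtain ⟨t, ht, j', hj', rfl⟩ := mem_hBlock.1 hy
          rw [Finset.mem_singleton] at hj'
          subst hj'
          exact hready₂ t ht) hnew₂ hopY hYr (by omega)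
      rw [hmerge s₂ hYm₂] at h
      exact h.mono (by omega)
    | some j =>
      have hvc : G.Clean s₂ (v i j) := hclean₂ _ (by simp [layer]) (by simp [layer])
      have hvs : G.IsSource (v i j) := isSource_of_layer_eq_zero rfl
      have hvY : Disjoint {v i j} Y := by
        rw [Finset.disjoint_singleton_left]
        intro h
        have := hYl _ h
        simp [layer] at this
      have hle := Finset.card_le_card (Finset.subset_union_left (s₁ := s₂.red) (s₂ := Y))
      have h1 := Reaches.avail_source (M := M) hvc hvs (by omega)
      have hYmv : ∀ y ∈ Y, (G.avail s₂ {v i j}).marked y = s₂.marked y := by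
        intro y hy
        have : y ≠ v i j := by rintro rfl; simp at hvY; exact hvY hy
        simp [CompDAG.avail, this]
      have hop : ∀ y ∈ Y, ∃ t ∈ T, hOperand i y = hprod i t j := by
        intro y hy
        obtain ⟨t, ht, j', hj', rfl⟩ := mem_hBlock.1 hy
        rw [Finset.mem_singleton] at hj'
        subst hj'
        exact ⟨t, ht, rfl⟩
      have h2 := Reaches.aggregate_map_products (G := G) (M := M) (s := G.avail s₂ {v i j}) Y
        (hOperand i) hpar
        (by
          intro y hy
          obtain ⟨t, ht, h⟩ := hop y hy
          rw [h]
          exact (hclean₂ _ (by simp [layer]) (by simp [layer])).avail (by simp))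
        (by
          intro y hy
          obtain ⟨t, ht, h⟩ := hop y hy
          rw [h]
          exact not_isSource_hprod _ _ _)
        (by
          intro y hy p hp
          obtain ⟨t, ht, h⟩ := hop y hy
          rw [h, hG, parents_attentionDAG] at hp
          simp only [parents, Finset.mem_insert, Finset.mem_singleton] at hp
          rcases hp with rfl | rfl
          · refine ⟨(hready₂ t ht).avail, fun h => ?_⟩
            have := hYl _ h
            simp [layer] at this
          · exact ⟨ready_avail (by simp), Finset.disjoint_singleton_left.1 hvY⟩)
        (by
          intro y hy
          rw [hYmv y hy]
          exact hnew₂ y hy) hopY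
        (by
          intro y hy
          have := hYr y hy
          simp only [CompDAG.avail, Finset.mem_union]
          tauto)
        (by
          have h2 := Finset.card_union_le (s₂.red ∪ Y) {v i j}
          rw [Finset.card_singleton] at h2
          simp only [CompDAG.avail]
          rw [Finset.union_right_comm]
          omega)
      rw [upd_avail hvY, hmerge _ fun y hy => (hYmv y hy).trans (hYm₂ y hy)] at h2
      refine ((h1.trans h2).trans (Reaches.release _ ?_ ?_)).mono (by omega)
      · rw [← hmerge s₂ hYm₂]
        simpa using hvc.upd (Finset.disjoint_singleton_left.1 hvY)
      · rw [← hmerge s₂ hYm₂]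
        have h2 := Finset.card_union_le (s₂.red ∪ Y) {v i j}
        rw [Finset.card_singleton] at h2
        simp only [PebbleState.upd]
        omega)
  have hdisj : Disjoint U (hBlock n T J) :=
    disjoint_of_layer_ne fun x hx y hy => by rw [hUl x hx, layer_of_mem_hBlock hy]; omega
  simp only [hBlock_empty, upd_empty, mul_one] at h2
  have hm : ((G.avail s U).upd (hBlock n T J)
      fun y => insert (hOperand i y) ((G.avail s U).marked y)) =
      G.avail (s.upd (hBlock n T J) fun y => insert (hOperand i y) (s.marked y)) U := by
    rw [upd_avail hdisj]
    congr 1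
    ext1
    · rfl
    · rfl
    · ext1 x
      by_cases hx : x ∈ hBlock n T J
      · simp [PebbleState.upd, hx, CompDAG.avail, Finset.disjoint_right.1 hdisj hx]
      · simp [PebbleState.upd, hx]
  rw [hm] at h2
  refine (h1.trans h2).trans (c' := 0) (Reaches.release U ?_ ?_)
  · exact fun x hx => (hclean x (by rw [hUl x hx]; omega)).upd (Finset.disjoint_left.1 hdisj hx)
  · have := Finset.card_union_le (s.red ∪ hBlock n T J) U
    simp only [PebbleState.upd]
    omega

/-- A block of `U₂ᵀ [V 1]` is computed in fast memory. -/
theorem reaches_avail_hBlock (hn : 0 < n) (S : Finset (Fin d))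
    (hS : ∀ t ∈ T, ∀ c, t.1 c ≠ 0 → c ∈ S)
    (hclean : ∀ x : AttnNode n d g, x.layer ≤ 3 → (attentionDAG n d g).Clean s x)
    (hcap : (s.red ∪ hBlock n T J).card + T.card + 2 ≤ M) :
    (attentionDAG n d g).Reaches M s ((attentionDAG n d g).avail s (hBlock n T J))
      (n * (S.card + 1 + J.card)) := by
  have : Nonempty (Fin n) := ⟨⟨0, hn⟩⟩
  set G := attentionDAG n d g with hG
  set Y := hBlock n T J with hY
  have hYl : ∀ y ∈ Y, y.layer = 3 := fun y hy => layer_of_mem_hBlock hy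
  have hYc : ∀ y ∈ Y, G.Clean s y := fun y hy => hclean y (hYl y hy).le
  have hYb : ∀ y ∈ Y, y ∉ s.blue := by
    intro y hy
    rw [(hYc y hy).2.1]
    obtain ⟨t, _, j, _, rfl⟩ := mem_hBlock.1 hy
    exact not_isSource_h hn t j
  -- The empty set is treated separately: `upd` puts the block into fast memory even with no operand
  -- aggregated, whereas before the first row the block is absent.
  have h := Reaches.loop (G := G) (M := M) (c := S.card + 1 + J.card)
    (fun D : Finset (Fin n) => if D = ∅ then s else
      s.upd Y fun y => D.image fun i => hOperand i y) Finset.univ (by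
    intro D _ i _ hiD
    by_cases hD : D = ∅
    · subst hD
      simp only [if_true, Finset.insert_ne_empty, if_false]
      convert reaches_aggregate_row (M := M) (J := J) (s := s) i S hS
        (fun x hx => hclean x (by omega)) (fun y hy => Or.inr (hYb y hy))
        (fun y hy => by simp [(hYc y hy).2.2]) hcap using 1
      ext1
      · rfl
      · rfl
      · ext1 x
        by_cases hx : x ∈ Y
        · simp [upd, ← hY, hx, (hYc x hx).2.2]
        · simp [upd, ← hY, hx]
    · simp only [hD, Finset.insert_ne_empty, if_false]
      convert reaches_aggregate_row (M := M) (J := J)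
        (s := s.upd Y fun y => D.image fun i => hOperand i y) i S hS
        (fun x hx => (hclean x (by omega)).upd fun hxY => by
          have := hYl x hxY
          omega) (fun y hy => Or.inl (Finset.mem_union_right _ hy))
        (fun y hy => by
          simp only [PebbleState.upd, ← hY] at hy ⊢
          simp only [hy, if_true, Finset.mem_image, not_exists, not_and]
          rintro i' hi' h
          exact hiD (hOperand_injective y (hYl y hy) h ▸ hi'))
        (by simpa [PebbleState.upd, Finset.union_assoc, hY] using hcap) using 1
      ext1
      · simp [upd, ← hY]
      · simp [upd, ← hY]
      · ext1 x
        by_cases hx : x ∈ Y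
        · simp [upd, ← hY, hx, Finset.image_insert]
        · simp [upd, ← hY, hx])
  simp only [if_true, Finset.univ_eq_empty_iff, not_isEmpty_of_nonempty, if_false,
    Finset.card_univ, Fintype.card_fin] at h
  convert h using 1
  ext1
  · rfl
  · simp only [avail, upd]
    ext x
    simp only [Set.mem_sdiff, Finset.mem_coe, iff_self_and]
    exact fun hx hxY => hYb x hxY hx
  · ext1 x
    by_cases hx : x ∈ Y
    · obtain ⟨t, _, j, _, rfl⟩ := mem_hBlock.1 hx
      simp only [avail, upd, hx, if_true, hG, parents_attentionDAG, parents_h]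
    · simp [avail, upd, hx]

/-- A block of `U₂ᵀ [V 1]` in fast memory contributes to row `i` of `U₁ (U₂ᵀ [V 1])`. -/
theorem reaches_accumulate_row (i : Fin n) (S : Finset (Fin d)) (hT : T.Nonempty)
    (hS : ∀ t ∈ T, ∀ c, t.1 c ≠ 0 → c ∈ S)
    (hclean : ∀ x : AttnNode n d g, x.layer ≤ 2 ∨ x.layer = 4 → (attentionDAG n d g).Clean s x)
    (hh : ∀ y ∈ hBlock n T J, (attentionDAG n d g).Ready s y)
    (ho : ∀ y ∈ oBlock g {i} J, y ∉ s.red)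
    (hnew : ∀ y ∈ oBlock g {i} J, Disjoint (oOperands T y) (s.marked y))
    (hcap : s.red.card + T.card + 2 ≤ M) :
    (attentionDAG n d g).Reaches M s
      (s.store (oBlock g {i} J) fun y => s.marked y ∪ oOperands T y)
      (S.card + 1 + J.card * 2) := by
  set G := attentionDAG n d g with hG
  set U : Finset (AttnNode n d g) := T.image (u₁ i) with hU
  have hUl : ∀ x ∈ U, x.layer = 1 := by
    intro x hx
    obtain ⟨t, _, rfl⟩ := Finset.mem_image.1 hx
    rfl
  have hUc : U.card ≤ T.card := Finset.card_image_le
  have hUcap := Finset.card_union_le s.red U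
  have h1 : G.Reaches M s (G.avail s U) (S.card + 1) := by
    refine (Reaches.build (G := G) (M := M) (s := s) U (S.image (q i))
      (fun x hx => hclean x (by rw [hUl x hx]; omega)) ?_ ?_ ?_ ?_ (by omega)).mono ?_
    · intro x hx
      obtain ⟨c, _, rfl⟩ := Finset.mem_image.1 hx
      exact hclean _ (by simp [layer])
    · intro x hx
      obtain ⟨c, _, rfl⟩ := Finset.mem_image.1 hx
      exact isSource_of_layer_eq_zero rfl
    · refine disjoint_of_layer_ne fun x hx y hy => ?_
      obtain ⟨c, _, rfl⟩ := Finset.mem_image.1 hy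
      rw [hUl x hx]
      simp [layer]
    · intro x hx
      obtain ⟨t, ht, rfl⟩ := Finset.mem_image.1 hx
      exact Finset.image_subset_image fun c hc => hS t ht c (Finset.mem_filter.1 hc).2
    · refine add_le_add Finset.card_image_le (card_constant_terms_le _ ?_ T)
      intro t ht c
      simpa [parents] using Finset.filter_eq_empty_iff.1 (Finset.image_eq_empty.1 ht)
        (Finset.mem_univ c)
  set Y : Finset (AttnNode n d g) := oBlock g {i} J with hY
  have hYl : ∀ y ∈ Y, y.layer = 5 := fun y hy => layer_of_mem_oBlock hy
  have hYe : ∀ y ∈ Y, ∃ j ∈ J, y = o i j := by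
    intro y hy
    obtain ⟨i', hi', j, hj, rfl⟩ := mem_oBlock.1 hy
    rw [Finset.mem_singleton] at hi'
    exact ⟨j, hj, by rw [hi']⟩
  have hdisj : Disjoint U Y :=
    disjoint_of_layer_ne fun x hx y hy => by rw [hUl x hx, hYl y hy]; omega
  have hYm : ∀ y ∈ Y, (G.avail s U).marked y = s.marked y := fun y hy => by
    simp [CompDAG.avail, Finset.disjoint_right.1 hdisj hy]
  have hop : ∀ y ∈ Y, ∀ w ∈ oOperands T y, ∃ t ∈ T, ∃ j ∈ J, w = oprod i t j := by
    intro y hy w hw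
    obtain ⟨j, hj, rfl⟩ := hYe y hy
    obtain ⟨t, ht, rfl⟩ := Finset.mem_image.1 hw
    exact ⟨t, ht, j, hj, rfl⟩
  have h2 := Reaches.accumulate (G := G) (M := M) (s := G.avail s U) Y (oOperands T)
    (by
      intro y hy
      simp [CompDAG.avail, ho y hy, Finset.disjoint_right.1 hdisj hy])
    (by
      intro y hy
      obtain ⟨j, _, rfl⟩ := hYe y hy
      exact hT.image _)
    (by
      intro y hy
      obtain ⟨j, _, rfl⟩ := hYe y hy
      exact Finset.image_subset_image (Finset.subset_univ _))
    (by
      intro y hy w hw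
      obtain ⟨t, ht, j, hj, rfl⟩ := hop y hy w hw
      refine ⟨(hclean _ (by simp [layer])).avail fun h => ?_, not_isSource_oprod _ _ _⟩
      have := hUl _ h
      simp [layer] at this)
    (by
      intro y hy w hw h
      obtain ⟨t, ht, j, hj, rfl⟩ := hop y hy w hw
      have := hYl _ h
      simp [layer] at this)
    (by
      intro y hy w hw p hp
      obtain ⟨t, ht, j, hj, rfl⟩ := hop y hy w hw
      rw [hG, parents_attentionDAG] at hp
      simp only [parents, Finset.mem_insert, Finset.mem_singleton] at hp
      rcases hp with rfl | rfl
      · exact ready_avail (Finset.mem_image_of_mem _ ht)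
      · exact (hh _ (mem_hBlock.2 ⟨t, ht, j, hj, rfl⟩)).avail)
    (fun y hy => by rw [hYm y hy]; exact hnew y hy)
    (by simp only [CompDAG.avail]; omega)
  rw [store_avail hdisj] at h2
  have hm : (s.store Y fun y => (G.avail s U).marked y ∪ oOperands T y) =
      s.store Y fun y => s.marked y ∪ oOperands T y := by
    ext1
    · rfl
    · rfl
    · ext1 x
      by_cases hx : x ∈ Y
      · simp [PebbleState.store, hx, hYm x hx]
      · simp [PebbleState.store, hx]
  rw [hm] at h2
  refine ((h1.trans h2).trans (Reaches.release U ?_ ?_)).mono ?_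
  · exact fun x hx => (hclean x (by rw [hUl x hx]; omega)).store (Finset.disjoint_left.1 hdisj hx)
  · simp only [PebbleState.store]
    omega
  · have := card_oBlock_le (g := g) (I := {i}) (J := J)
    rw [Finset.card_singleton, one_mul, ← hY] at this
    omega

/-- The contribution of the terms `T` to the columns `J` of `U₁ (U₂ᵀ [V 1])`. -/
theorem reaches_accumulate_block (hn : 0 < n) (S : Finset (Fin d)) (hT : T.Nonempty)
    (hS : ∀ t ∈ T, ∀ c, t.1 c ≠ 0 → c ∈ S)
    (hclean : ∀ x : AttnNode n d g, x.layer ≤ 4 → (attentionDAG n d g).Clean s x)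
    (hred : s.red = ∅)
    (hnew : ∀ y ∈ oBlock g Finset.univ J, Disjoint (oOperands T y) (s.marked y))
    (hcap : T.card * J.card + T.card + 2 ≤ M) :
    (attentionDAG n d g).Reaches M s
      (s.store (oBlock g Finset.univ J) fun y => s.marked y ∪ oOperands T y)
      (n * (2 * S.card + 2 + 3 * J.card)) := by
  set G := attentionDAG n d g with hG
  set H := hBlock n T J with hH
  have hHc : H.card ≤ T.card * J.card := card_hBlock_le
  have hHl : ∀ y ∈ H, y.layer = 3 := fun y hy => layer_of_mem_hBlock hy
  have h1 : G.Reaches M s (G.avail s H) _ := reaches_avail_hBlock (M := M) hn S hS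
    (fun x hx => hclean x (by omega)) (by rw [hred, Finset.empty_union, ← hH]; omega)
  have hm₁ : ∀ y : AttnNode n d g, y.layer = 5 → (G.avail s H).marked y = s.marked y := by
    intro y hy
    have : y ∉ H := fun h => by have := hHl y h; omega
    simp [CompDAG.avail, this]
  -- The block stays in fast memory throughout this pass over the rows of `Q`, and is discarded only
  -- afterwards.
  have h2 := Reaches.loop (G := G) (M := M) (c := S.card + 1 + J.card * 2)
    (fun D : Finset (Fin n) => (G.avail s H).store (oBlock g D J)
      fun y => (G.avail s H).marked y ∪ oOperands T y) Finset.univ (by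
    intro D _ i _ hiD
    have hdisj : Disjoint (oBlock g D J) (oBlock g {i} J) := by
      rw [Finset.disjoint_left]
      intro x hx hx'
      obtain ⟨i', hi', j', _, rfl⟩ := mem_oBlock.1 hx
      obtain ⟨i'', hi'', j'', _, h⟩ := mem_oBlock.1 hx'
      simp only [AttnNode.o.injEq, Finset.mem_singleton] at h hi''
      exact hiD (hi'' ▸ h.1 ▸ hi')
    have hm₂ : ∀ y ∈ oBlock g {i} J, ((G.avail s H).store (oBlock g D J)
        fun y => (G.avail s H).marked y ∪ oOperands T y).marked y = s.marked y := by
      intro y hy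
      simp only [PebbleState.store, Finset.disjoint_right.1 hdisj hy, if_false]
      exact hm₁ y (layer_of_mem_oBlock hy)
    have h := reaches_accumulate_row (M := M) (J := J) (s := (G.avail s H).store (oBlock g D J)
      fun y => (G.avail s H).marked y ∪ oOperands T y) i S hT hS
      (fun x hx => ((hclean x (by omega)).avail fun h => by
        have := hHl x h; omega).store fun h => by have := layer_of_mem_oBlock h; omega)
      (fun y hy => (ready_avail hy).store fun h => by
        have := layer_of_mem_oBlock h
        have := hHl y hy
        omega)
      (fun y hy h => by
        simp only [PebbleState.store, CompDAG.avail, hred, Finset.empty_union] at h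
        have := layer_of_mem_oBlock hy
        have := hHl y h
        omega)
      (fun y hy => by
        rw [hm₂ y hy]
        exact hnew y (oBlock_mono (Finset.subset_univ _) hy))
      (by simp only [PebbleState.store, CompDAG.avail, hred, Finset.empty_union]; omega)
    convert h using 1
    ext1
    · rfl
    · simp [store, oBlock_insert, Set.union_assoc]
    · ext1 x
      by_cases hx : x ∈ oBlock g {i} J
      · have h1 := hm₁ x (layer_of_mem_oBlock hx)
        simp [store, hx, Finset.disjoint_right.1 hdisj hx, oBlock_insert]
      · simp [store, hx, oBlock_insert])
  simp only [oBlock_empty, store_empty, Finset.card_univ, Fintype.card_fin] at h2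
  have hdisj : Disjoint H (oBlock g Finset.univ J) :=
    disjoint_of_layer_ne fun x hx y hy => by rw [hHl x hx, layer_of_mem_oBlock hy]; omega
  rw [store_avail hdisj] at h2
  have hm : (s.store (oBlock g Finset.univ J) fun y => (G.avail s H).marked y ∪ oOperands T y) =
      s.store (oBlock g Finset.univ J) fun y => s.marked y ∪ oOperands T y := by
    ext1
    · rfl
    · rfl
    · ext1 x
      by_cases hx : x ∈ oBlock g Finset.univ J
      · simp [PebbleState.store, hx, hm₁ x (layer_of_mem_oBlock hx)]
      · simp [PebbleState.store, hx]
  rw [hm] at h2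
  refine ((h1.trans h2).trans (Reaches.release H ?_ ?_)).mono (le_of_eq (by ring))
  · exact fun x hx => (hclean x (by rw [hHl x hx]; omega)).store (Finset.disjoint_left.1 hdisj hx)
  · simp only [PebbleState.store, hred, Finset.empty_union]
    omega

/-! ### Partial outputs between blocks -/

/-- The state in which the products with the indices in `D` have been aggregated into
`U₁ (U₂ᵀ [V 1])`, and fast memory is empty. -/
def baseState (n : ℕ) (D : Finset (Term d g × Option (Fin d))) :
    PebbleState (AttnNode n d g) where
  red := ∅
  blue := {x | (attentionDAG n d g).IsSource x ∨ ∃ p ∈ D, ∃ i, x = o i p.2}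
  marked
    | o i j => (Finset.univ.filter fun t => (t, j) ∈ D).image fun t => oprod i t j
    | _ => ∅

theorem baseState_empty : baseState n (∅ : Finset (Term d g × Option (Fin d))) =
    (attentionDAG n d g).initialState := by
  ext1
  · rfl
  · ext x; simp [baseState, initialState]
  · ext1 x
    cases x <;> simp [baseState, initialState]

theorem clean_baseState (D : Finset (Term d g × Option (Fin d))) (x : AttnNode n d g)
    (hx : x.layer ≠ 5) : (attentionDAG n d g).Clean (baseState n D) x := by
  refine ⟨by simp [baseState], ?_, ?_⟩
  · simp only [baseState, Set.mem_ofPred_eq, or_iff_left_iff_imp]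
    rintro ⟨p, _, i, rfl⟩
    simp [layer] at hx
  · cases x <;> simp [layer] at hx <;> rfl

/-- Fast memory is empty before and after a block, so the state only depends on the set of index
pairs already treated. This is what allows blocks to be chained. -/
theorem reaches_baseState (hn : 0 < n) (S : Finset (Fin d)) (hT : T.Nonempty)
    (hS : ∀ t ∈ T, ∀ c, t.1 c ≠ 0 → c ∈ S) (D : Finset (Term d g × Option (Fin d)))
    (hD : ∀ t ∈ T, ∀ j ∈ J, (t, j) ∉ D) (hcap : T.card * J.card + T.card + 2 ≤ M) :
    (attentionDAG n d g).Reaches M (baseState n D) (baseState n (D ∪ T ×ˢ J))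
      (n * (2 * S.card + 2 + 3 * J.card)) := by
  convert reaches_accumulate_block (M := M) (s := baseState n D) hn S hT hS
    (fun x hx => clean_baseState D x (by omega)) rfl ?_ hcap using 1
  · ext1
    · rfl
    · ext x
      obtain ⟨t₀, ht₀⟩ := hT
      simp only [baseState, store, Set.mem_ofPred_eq, Finset.mem_union, Finset.mem_product,
        Set.mem_union, Finset.mem_coe, mem_oBlock, Finset.mem_univ, true_and, or_assoc]
      refine or_congr_right ?_
      constructor
      · rintro ⟨p, hp | hp, i, rfl⟩
        · exact Or.inl ⟨p, hp, i, rfl⟩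
        · exact Or.inr ⟨i, p.2, hp.2, rfl⟩
      · rintro (⟨p, hp, i, rfl⟩ | ⟨i, j, hj, rfl⟩)
        · exact ⟨p, Or.inl hp, i, rfl⟩
        · exact ⟨(t₀, j), Or.inr ⟨ht₀, hj⟩, i, rfl⟩
    · ext1 x
      by_cases hx : x ∈ oBlock g Finset.univ J
      · simp only [store, hx, if_true]
        obtain ⟨i, _, j, hj, rfl⟩ := mem_oBlock.1 hx
        simp only [baseState, oOperands, ← Finset.image_union]
        congr 1
        ext t
        simp [hj]
      · simp only [store, hx, if_false]
        cases x <;> try rfl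
        case o i j =>
          have hj : j ∉ J := fun hj => hx (mem_oBlock.2 ⟨i, Finset.mem_univ _, j, hj, rfl⟩)
          simp [baseState, hj]
  · intro y hy
    obtain ⟨i, _, j, hj, rfl⟩ := mem_oBlock.1 hy
    simp only [baseState, oOperands]
    rw [Finset.disjoint_left]
    intro x hx hx'
    obtain ⟨t, ht, rfl⟩ := Finset.mem_image.1 hx
    obtain ⟨t', ht', h⟩ := Finset.mem_image.1 hx'
    simp only [oprod.injEq, true_and, and_true] at h
    subst h
    exact hD _ ht j hj (Finset.mem_filter.1 ht').2

end AttnNode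

/-! ### The division by `D` and the total cost for given partitions -/

namespace CompDAG

open PebbleState

variable {V : Type*} [DecidableEq V] {G : CompDAG V} {M : ℕ} {s : PebbleState V}

theorem Reaches.evict_all (X : Finset V) (hX : ∀ x ∈ X, x ∈ s.blue) (hcap : X.card ≤ M) :
    G.Reaches M { s with red := X } { s with red := ∅ } 0 := by
  induction X using Finset.induction_on with
  | empty => exact Reaches.refl _
  | insert x X hx ih =>
    simp only [Finset.mem_insert, forall_eq_or_imp] at hX
    have h := Reaches.evict (G := G) (M := M) (s := { s with red := insert x X }) hX.1 hcap
    simp only [Finset.erase_insert hx] at h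
    exact h.trans (ih hX.2 ((Finset.card_le_card (Finset.subset_insert _ _)).trans hcap))

/-- A node whose operands are in slow memory is computed and saved. -/
theorem Reaches.compute_and_store {v : V} (hred : s.red = ∅) (hv : G.Clean s v)
    (hs : ¬ G.IsSource v) (hp : ∀ p ∈ G.parents v, p ∈ s.blue ∧ G.Complete s p)
    (hcap : (G.parents v).card + 1 ≤ M) :
    G.Reaches M s (s.store {v} G.parents) ((G.parents v).card + 1) := by
  set P := G.parents v with hP
  have hvP : v ∉ P := not_mem_parents_self v
  have h1 := Reaches.loop (G := G) (M := M) (c := 1) (fun D => { s with red := D }) P (by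
    intro D hD x hx hxD
    refine Reaches.load (G := G) (M := M) (s := { s with red := D }) (hp x hx).1 ?_
    exact (Nat.succ_le_succ (Finset.card_le_card hD)).trans hcap)
  have hs0 : ({ s with red := ∅ } : PebbleState V) = s := by rw [← hred]
  rw [hs0, mul_one] at h1
  have h2 := Reaches.avail_single (G := G) (M := M) (s := { s with red := P }) (v := v)
    ⟨hvP, hv.2⟩ hs (fun p hp' => ⟨hp', (hp p hp').2⟩) hcap
  have hc : (P ∪ {v}).card ≤ M := (Finset.card_union_le _ _).trans hcap
  have h3 := Reaches.save (G := G) (M := M) (s := G.avail { s with red := P } {v}) (v := v)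
    (by simp [CompDAG.avail]) hc
  have h4 := Reaches.evict_all (G := G) (M := M) (s := s.store {v} G.parents) (P ∪ {v})
    (by
      intro x hx
      rcases Finset.mem_union.1 hx with hx | hx
      · exact Or.inl (hp x hx).1
      · exact Or.inr (by simpa using hx)) hc
  have e1 : ({ (G.avail { s with red := P } {v}) with
      blue := insert v (G.avail { s with red := P } {v}).blue } : PebbleState V) =
      { s.store {v} G.parents with red := P ∪ {v} } := by
    ext1
    · rfl
    · simp [CompDAG.avail, PebbleState.store]
    · rfl
  have e2 : ({ s.store {v} G.parents with red := ∅ } : PebbleState V) = s.store {v} G.parents := by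
    rw [← hred]
    rfl
  rw [e1] at h3
  rw [e2] at h4
  exact ((h1.trans h2).trans h3).trans h4

end CompDAG

namespace AttnNode

open CompDAG PebbleState

variable {n d g M : ℕ}

/-- Every other node is used: entries of `Q` and `K` by the linear monomials, which exist because `g
> 0`, and the diagonal of `D` by some output, because `d > 0`. -/
theorem eq_out_of_isSink (hn : 0 < n) (hd : 0 < d) (hg : 0 < g) {x : AttnNode n d g}
    (hx : (attentionDAG n d g).IsSink x) : ∃ i j, x = out i j := by
  set zero : Term d g := ⟨fun _ => 0, by simp⟩
  set single : Fin d → Term d g := fun c =>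
    ⟨fun c' => if c' = c then ⟨1, by omega⟩ else 0, by
      simp only [apply_ite Fin.val, Fin.val_zero, Finset.sum_ite_eq', Finset.mem_univ, if_true]
      omega⟩ with hsingle
  have hne : ∀ c, (single c).1 c ≠ 0 := by
    intro c h
    have := congrArg Fin.val h
    simp [hsingle] at this
  cases x with
  | q i c =>
    exact (hx (u₁ i (single c)) (Finset.mem_image_of_mem _ (by simpa using hne c))).elim
  | k i c =>
    exact (hx (u₂ i (single c)) (Finset.mem_image_of_mem _ (by simpa using hne c))).elim
  | v i j => exact (hx (hprod i zero j) (by simp [parents_attentionDAG, parents])).elim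
  | u₁ i t => exact (hx (oprod i t none) (by simp [parents_attentionDAG, parents])).elim
  | u₂ i t => exact (hx (h t none) (Finset.mem_image_of_mem _ (Finset.mem_univ i))).elim
  | hprod i t j =>
    exact (hx (h t (some j)) (Finset.mem_image_of_mem (fun i => hprod i t j)
      (Finset.mem_univ i))).elim
  | h t j => exact (hx (oprod ⟨0, hn⟩ t j) (by simp [parents_attentionDAG, parents])).elim
  | oprod i t j =>
    exact (hx (o i j) (Finset.mem_image_of_mem (fun t => oprod i t j) (Finset.mem_univ t))).elim
  | o i j =>
    cases j with
    | none => exact (hx (out i ⟨0, hd⟩) (by simp [parents_attentionDAG, parents])).elim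
    | some j => exact (hx (out i j) (by simp [parents_attentionDAG, parents])).elim
  | out i j => exact ⟨i, j, rfl⟩

/-- The cost of processing the classes of a partition of the terms, each together with the classes
of a partition of the columns. -/
theorem optimalCost_attentionDAG_le {κ κ' : Type*} [DecidableEq κ] [DecidableEq κ']
    (hn : 0 < n) (hd : 0 < d) (hg : 0 < g) (f : Term d g → κ) (f' : Option (Fin d) → κ')
    {τ w σ : ℕ} (hτ : ∀ x, (Finset.univ.filter fun t => f t = x).card ≤ τ)
    (hw : ∀ x, (Finset.univ.filter fun j => f' j = x).card ≤ w)
    (hσ : ∀ x, ∃ S : Finset (Fin d), S.card ≤ σ ∧ ∀ t, f t = x → ∀ c, t.1 c ≠ 0 → c ∈ S)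
    (hcap : τ * w + τ + 2 ≤ M) (hM : 3 ≤ M) :
    (attentionDAG n d g).optimalCost M ≤
      ((Finset.univ.image f).card * (Finset.univ.image f').card * (n * (2 * σ + 2 + 3 * w)) +
        n * d * 3 : ℕ) := by
  set G := attentionDAG n d g with hG
  set A := Finset.univ.image f ×ˢ Finset.univ.image f' with hA
  set D : Finset (κ × κ') → Finset (Term d g × Option (Fin d)) := fun B =>
    Finset.univ.filter fun p => (f p.1, f' p.2) ∈ B with hD
  have h1 := Reaches.loop (G := G) (M := M) (c := n * (2 * σ + 2 + 3 * w))
    (fun B => baseState n (D B)) A (by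
    rintro B _ ⟨x, x'⟩ hx hxB
    set T := Finset.univ.filter fun t => f t = x with hT
    set J := Finset.univ.filter fun j => f' j = x' with hJ
    obtain ⟨S, hSσ, hS⟩ := hσ x
    have hTne : T.Nonempty := by
      obtain ⟨t, _, ht⟩ := Finset.mem_image.1 (Finset.mem_product.1 hx).1
      exact ⟨t, by simpa [hT] using ht⟩
    have hDB : D (insert (x, x') B) = D B ∪ T ×ˢ J := by
      ext p
      simp only [hD, hT, hJ, Finset.mem_filter, Finset.mem_univ, true_and, Finset.mem_insert,
        Finset.mem_union, Finset.mem_product, Prod.mk.injEq]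
      tauto
    simp only [hDB]
    refine (reaches_baseState (M := M) hn S hTne (fun t ht => hS t (by simpa [hT] using ht)) _
      ?_ ?_).mono ?_
    · intro t ht j hj h
      simp only [hT, hJ, hD, Finset.mem_filter, Finset.mem_univ, true_and] at ht hj h
      rw [ht, hj] at h
      exact hxB h
    · have hTτ : T.card ≤ τ := hτ x
      have hJw : J.card ≤ w := hw x'
      have := Nat.mul_le_mul hTτ hJw
      omega
    · have hJw : J.card ≤ w := hw x'
      exact Nat.mul_le_mul_left _ (by omega))
  have hD0 : D ∅ = ∅ := by simp [hD]
  have hD1 : D A = Finset.univ := by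
    ext p
    simp [hD, hA]
  simp only [hD0, hD1] at h1
  rw [baseState_empty] at h1
  set s : PebbleState (AttnNode n d g) := baseState n Finset.univ with hs
  set O : Finset (Fin n × Fin d) → Finset (AttnNode n d g) := fun B =>
    B.image fun p => out p.1 p.2 with hO
  have hOl : ∀ B, ∀ x ∈ O B, x.layer = 6 := by
    intro B x hx
    obtain ⟨p, _, rfl⟩ := Finset.mem_image.1 hx
    rfl
  have hob : ∀ B i j, o i j ∈ (s.store (O B) G.parents).blue ∧
      G.Complete (s.store (O B) G.parents) (o i j) := by
    intro B i j
    have : (o i j : AttnNode n d g) ∉ O B := fun h => by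
      have := hOl B _ h
      simp [layer] at this
    -- The constant monomial witnesses that the entry has received an operand and hence lies in slow
    -- memory.
    refine ⟨Or.inl (Or.inr ⟨(⟨fun _ => 0, by simp⟩, j), Finset.mem_univ _, i, rfl⟩), ?_⟩
    simp only [Complete, PebbleState.store, this, if_false]
    simp [hs, baseState, hG, parents_attentionDAG, parents]
  -- Each quotient takes two loads and one save.
  have h2 := Reaches.loop (G := G) (M := M) (c := 3) (fun B => s.store (O B) G.parents)
    Finset.univ (by
    rintro B _ ⟨i, j⟩ _ hB
    have hpc : (G.parents (out i j)).card ≤ 2 := Finset.card_le_two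
    have houtB : (out i j : AttnNode n d g) ∉ O B := by
      simpa [hO] using hB
    have h := Reaches.compute_and_store (G := G) (M := M) (s := s.store (O B) G.parents)
      (v := out i j) rfl
      ((clean_baseState _ _ (by simp [layer])).store houtB)
      (by simp [hG, isSource_iff, parents])
      (by
        intro p hp
        simp only [hG, parents_attentionDAG, parents, Finset.mem_insert,
          Finset.mem_singleton] at hp
        rcases hp with rfl | rfl
        · exact hob B i (some j)
        · exact hob B i none) (by omega)
    convert h.mono (show _ ≤ 3 by omega) using 1
    ext1
    · rfl
    · ext y
      simp only [store, hO, Finset.image_insert, Finset.coe_insert, Finset.coe_singleton,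
        Set.mem_union, Set.mem_insert_iff, Set.mem_singleton_iff]
      tauto
    · ext1 x
      by_cases hx : x = out i j
      · subst hx; simp [store, hO]
      · have : x ∈ O (insert (i, j) B) ↔ x ∈ O B := by
          simp [hO, hx]
        simp [store, hx, this])
  have hO0 : O ∅ = ∅ := by simp [hO]
  simp only [hO0, store_empty] at h2
  have hfin : G.IsFinal (s.store (O Finset.univ) G.parents) := by
    intro x hx
    obtain ⟨i, j, rfl⟩ := eq_out_of_isSink hn hd hg hx
    have : (out i j : AttnNode n d g) ∈ O Finset.univ := by simp [hO]
    exact ⟨Or.inr this, by simp [Complete, PebbleState.store, this]⟩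
  convert optimalCost_le (h1.trans h2) hfin using 2
  simp [hA]

end AttnNode

/-! ### Partitioning the monomials -/

/-- Every partition can be refined into few classes of bounded size. -/
theorem exists_refinement {α κ : Type*} [Fintype α] [DecidableEq κ] (key : α → κ) {τ : ℕ}
    (hτ : 0 < τ) :
    ∃ f : α → κ × ℕ, (∀ a, (f a).1 = key a) ∧
      (∀ x, (Finset.univ.filter fun a => f a = x).card ≤ τ) ∧
      (Finset.univ.image f).card ≤ Fintype.card α / τ + (Finset.univ.image key).card := by
  classical
  set C : κ → Finset α := fun x => Finset.univ.filter fun a => key a = x with hC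
  -- Each class is numbered and cut into runs of length `τ`; only the last run can be short, so a
  -- class `C` yields at most `|C| / τ + 1` pieces.
  set rank : α → ℕ := fun a => (C (key a)).equivFin ⟨a, by simp [hC]⟩ with hrank
  have hlt : ∀ a, rank a < (C (key a)).card := fun a => Fin.is_lt _
  have hinj : ∀ a b, key a = key b → rank a = rank b → a = b := by
    have : ∀ x a b (ha : a ∈ C x) (hb : b ∈ C x),
        ((C x).equivFin ⟨a, ha⟩ : ℕ) = (C x).equivFin ⟨b, hb⟩ → a = b := by
      intro x a b ha hb h
      simpa using (C x).equivFin.injective (Fin.ext h)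
    have hr : ∀ x a (ha : a ∈ C x), rank a = (C x).equivFin ⟨a, ha⟩ := by
      intro x a ha
      obtain rfl : key a = x := by simpa [hC] using ha
      rfl
    intro a b hab h
    have hb : b ∈ C (key a) := by simp [hC, hab]
    rw [hr (key a) b hb] at h
    exact this _ a b _ hb h
  refine ⟨fun a => (key a, rank a / τ), fun _ => rfl, ?_, ?_⟩
  · rintro ⟨x, m⟩
    have : (Finset.Ico (m * τ) (m * τ + τ)).card = τ := by simp
    refine le_of_le_of_eq ?_ this
    refine Finset.card_le_card_of_injOn rank ?_ ?_
    · intro a ha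
      simp only [Finset.coe_filter, Finset.mem_univ, true_and, Prod.mk.injEq,
        Set.mem_ofPred_eq] at ha
      simp only [Finset.coe_Ico, Set.mem_Ico]
      rw [← ha.2]
      exact ⟨Nat.div_mul_le_self _ _, Nat.lt_div_mul_add hτ⟩
    · intro a ha b hb h
      simp only [Finset.coe_filter, Finset.mem_univ, true_and, Prod.mk.injEq,
        Set.mem_ofPred_eq] at ha hb
      exact hinj a b (ha.1.trans hb.1.symm) h
  · have h1 : Finset.univ.image (fun a => (key a, rank a / τ)) ⊆
        (Finset.univ.image key).biUnion fun x =>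
          (Finset.range ((C x).card / τ + 1)).image fun m => (x, m) := by
      intro p hp
      obtain ⟨a, _, rfl⟩ := Finset.mem_image.1 hp
      simp only [Finset.mem_biUnion, Finset.mem_image, Finset.mem_univ, true_and,
        Finset.mem_range]
      exact ⟨key a, ⟨a, rfl⟩, rank a / τ,
        Nat.lt_succ_of_le (Nat.div_le_div_right (hlt a).le), rfl⟩
    refine (Finset.card_le_card h1).trans (Finset.card_biUnion_le.trans ?_)
    refine (Finset.sum_le_sum (g := fun x => (C x).card / τ + 1) fun x _ =>
      Finset.card_image_le.trans (Finset.card_range _).le).trans ?_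
    rw [Finset.sum_add_distrib, Finset.sum_const, smul_eq_mul, mul_one]
    refine Nat.add_le_add_right ?_ _
    rw [Nat.le_div_iff_mul_le hτ, Finset.sum_mul, ← Finset.card_univ,
      Finset.card_eq_sum_card_image key]
    exact Finset.sum_le_sum fun x _ => Nat.div_mul_le_self _ _

theorem card_filter_card_lt_le (m k : ℕ) (hm : 0 < m) :
    (Finset.univ.filter fun S : Finset (Fin m) => S.card < k).card ≤ k * m ^ k := by
  have h : (Finset.univ.filter fun S : Finset (Fin m) => S.card < k) ⊆
      (Finset.range k).biUnion fun i => Finset.univ.powersetCard i := by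
    intro S hS
    simpa [Finset.mem_powersetCard] using hS
  refine (Finset.card_le_card h).trans (Finset.card_biUnion_le.trans ?_)
  refine (Finset.sum_le_card_nsmul _ _ (m ^ k) fun i hi => ?_).trans (by simp)
  rw [Finset.card_powersetCard, Finset.card_univ, Fintype.card_fin]
  exact (Nat.choose_le_pow m i).trans (Nat.pow_le_pow_right hm (Finset.mem_range.1 hi).le)

theorem two_pow_le_centralBinom (g : ℕ) : 2 ^ g ≤ g.centralBinom := by
  induction g with
  | zero => simp
  | succ g ih =>
    have := Nat.succ_mul_centralBinom_succ g
    have h : (g + 1) * 2 ^ (g + 1) ≤ (g + 1) * (g + 1).centralBinom := by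
      rw [this, pow_succ]
      nlinarith
    exact Nat.le_of_mul_le_mul_left h (Nat.succ_pos g)

variable {d g : ℕ}

/-- Stars and bars: an extra variable `none` takes up the missing degree and makes the total exactly
`g`. -/
theorem card_term_le (d g : ℕ) : Fintype.card (Term d g) ≤ (d + g).choose g := by
  have h := Finset.card_finsuppAntidiag_nat_eq_choose
    (s := (Finset.univ : Finset (Option (Fin d)))) g
  rw [Finset.card_univ, Fintype.card_option, Fintype.card_fin,
    show d + 1 + g - 1 = d + g by omega] at h
  rw [← h, ← Finset.card_univ]
  refine Finset.card_le_card_of_injOn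
    (fun t => Finsupp.equivFunOnFinite.symm fun j : Option (Fin d) =>
      j.elim (g - ∑ c, (t.1 c : ℕ)) fun c => (t.1 c : ℕ)) ?_ ?_
  · intro t _
    rw [Finset.mem_coe, Finset.mem_finsuppAntidiag]
    refine ⟨?_, Finset.subset_univ _⟩
    simp only [Finsupp.equivFunOnFinite_symm_apply_apply, Fintype.sum_option, Option.elim]
    exact Nat.sub_add_cancel t.2
  · intro t _ t' _ h
    ext c
    have := DFunLike.congr_fun h (some c)
    simpa using this

theorem card_support_term_le (t : Term d g) : (Finset.univ.filter fun c => t.1 c ≠ 0).card ≤ g := by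
  refine le_trans ?_ t.2
  rw [Finset.card_filter]
  refine Finset.sum_le_sum fun c _ => ?_
  split_ifs with h
  · exact Nat.one_le_iff_ne_zero.2 fun h0 => h (Fin.ext h0)
  · exact Nat.zero_le _

/-- Replacing the variables of the blocks in `F` by one variable of each block. -/
theorem exists_term_replace {m : ℕ} (block : Fin d → Fin m) (t : Term d g) (F : Finset (Fin m))
    (hF : ∀ b ∈ F, ∃ c, block c = b ∧ t.1 c ≠ 0) (rep : Fin m → Fin d) :
    ∃ t' : Term d g, (∀ c, block c ∉ F → t'.1 c = t.1 c) ∧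
      ∀ c, block c ∈ F → (t'.1 c ≠ 0 ↔ c = rep (block c)) := by
  have hg : ∀ b ∈ F, 1 < g + 1 := by
    intro b hb
    obtain ⟨c, _, hc⟩ := hF b hb
    have := (t.1 c).2
    have : (t.1 c : ℕ) ≠ 0 := fun h0 => hc (Fin.ext h0)
    omega
  set l : Fin d → Fin (g + 1) := fun c =>
    if h : block c ∈ F then (if c = rep (block c) then ⟨1, hg _ h⟩ else 0) else t.1 c with hl
  -- Compared block by block: a block in `F` had degree at least 1 and now has degree at most 1; the
  -- others are unchanged.
  have hsum : ∑ c, (l c : ℕ) ≤ ∑ c, (t.1 c : ℕ) := by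
    rw [← Finset.sum_fiberwise Finset.univ block, ← Finset.sum_fiberwise Finset.univ block]
    refine Finset.sum_le_sum fun b _ => ?_
    by_cases hb : b ∈ F
    · obtain ⟨c, hc, hc0⟩ := hF b hb
      have h1 : ∑ c ∈ Finset.univ.filter (fun c => block c = b), (l c : ℕ) =
          ∑ c ∈ Finset.univ.filter (fun c => block c = b), if c = rep b then 1 else 0 := by
        refine Finset.sum_congr rfl fun c hc => ?_
        obtain rfl := (Finset.mem_filter.1 hc).2
        simp only [hl, hb, dif_pos]
        split_ifs <;> rfl
      rw [h1, Finset.sum_ite_eq']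
      have h2 : (t.1 c : ℕ) ≤ ∑ c ∈ Finset.univ.filter (fun c => block c = b), (t.1 c : ℕ) :=
        Finset.single_le_sum (f := fun c => (t.1 c : ℕ)) (fun _ _ => Nat.zero_le _)
          (by simpa using hc)
      have h3 : (t.1 c : ℕ) ≠ 0 := fun h0 => hc0 (Fin.ext h0)
      split_ifs <;> omega
    · refine Finset.sum_le_sum fun c hc => ?_
      obtain rfl := (Finset.mem_filter.1 hc).2
      simp [hl, hb]
  refine ⟨⟨l, hsum.trans t.2⟩, fun c hc => by simp [hl, hc], fun c hc => ?_⟩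
  simp only [hl, hc, dif_pos]
  split_ifs with h
  · simp [Fin.ext_iff, ← h]
  · simp [h]

/-- The terms of degree at most `g` in the variables of `m` blocks can be partitioned such that
each class involves few variables, and almost every class is large. -/
theorem exists_key_of_blocks {m B β : ℕ} (hm : 0 < m) (hB : 0 < B) (block : Fin d → Fin m)
    (rep : Fin m → Fin B → Fin d) (hrep : ∀ b x, block (rep b x) = b)
    (hinj : ∀ b, Function.Injective (rep b))
    (hβ : ∀ b, (Finset.univ.filter fun c => block c = b).card ≤ β) (k : ℕ) {τ : ℕ} (hτ : 0 < τ)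
    (hτB : τ ≤ B ^ k) :
    ∃ key : Term d g → Finset (Fin m) × (Fin d → Fin (g + 1)),
      (∀ x, ∃ S : Finset (Fin d), S.card ≤ g + k * β ∧
        ∀ t, key t = x → ∀ c, t.1 c ≠ 0 → c ∈ S) ∧
      (Finset.univ.image key).card ≤ Fintype.card (Term d g) / τ + k * m ^ k := by
  classical
  have hfree : ∀ S : Finset (Fin m), ∃ F ⊆ S, F.card = min k S.card := fun S =>
    Finset.exists_subset_card_eq (min_le_right _ _)
  choose free hfree_sub hfree_card using hfree
  set supp : Term d g → Finset (Fin m) := fun t =>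
    Finset.univ.filter fun b => ∃ c, block c = b ∧ t.1 c ≠ 0 with hsupp
  -- The key records the blocks met and the exponents outside the free blocks. The choice of free
  -- blocks depends only on the set of blocks met, so terms with equal keys have the same free
  -- blocks.
  set key : Term d g → Finset (Fin m) × (Fin d → Fin (g + 1)) := fun t =>
    (supp t, fun c => if block c ∈ free (supp t) then 0 else t.1 c) with hkey
  have hmem : ∀ t b, b ∈ supp t ↔ ∃ c, block c = b ∧ t.1 c ≠ 0 := by simp [hsupp]
  refine ⟨key, ?_, ?_⟩
  · intro x
    by_cases hx : ∃ t, key t = x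
    · obtain ⟨t, rfl⟩ := hx
      refine ⟨(Finset.univ.filter fun c => t.1 c ≠ 0) ∪
        (free (supp t)).biUnion fun b => Finset.univ.filter fun c => block c = b, ?_, ?_⟩
      · refine (Finset.card_union_le _ _).trans (add_le_add (card_support_term_le t) ?_)
        refine Finset.card_biUnion_le.trans
          ((Finset.sum_le_card_nsmul _ _ β fun b _ => hβ b).trans ?_)
        rw [smul_eq_mul]
        exact Nat.mul_le_mul_right _ ((hfree_card _).trans_le (min_le_left _ _))
      · intro t' ht' c hc
        simp only [Finset.mem_union, Finset.mem_filter, Finset.mem_univ, true_and,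
          Finset.mem_biUnion, exists_eq_right']
        by_cases hb : block c ∈ free (supp t)
        · exact Or.inr hb
        · left
          simp only [hkey, Prod.mk.injEq] at ht'
          have := congrFun ht'.2 c
          simp only [ht'.1, hb, if_false] at this
          rwa [← this]
    · exact ⟨∅, by simp, fun t ht => (hx ⟨t, ht⟩).elim⟩
  · rw [← Finset.card_filter_add_card_filter_not (s := Finset.univ.image key)
      (fun x => k ≤ x.1.card)]
    refine add_le_add ?_ ?_
    · rw [Nat.le_div_iff_mul_le hτ]
      have hclass : ∀ x ∈ (Finset.univ.image key).filter (fun x => k ≤ x.1.card),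
          τ ≤ (Finset.univ.filter fun t => key t = x).card := by
        intro x hx
        obtain ⟨hx, hk⟩ := Finset.mem_filter.1 hx
        obtain ⟨t, _, rfl⟩ := Finset.mem_image.1 hx
        set F := free (supp t) with hF
        have hFk : F.card = k := by rw [hF, hfree_card]; exact min_eq_left hk
        have hcard : Fintype.card (F → Fin B) = B ^ k := by simp [hFk]
        -- Choosing one of `B` variables in each of the `k` free blocks gives a term with the same
        -- key, and the choice can be read off from its support. So the class has at least `B ^ k`
        -- members.
        have hrepl : ∀ φ : F → Fin B, ∃ t' : Term d g, key t' = key t ∧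
            ∀ b (hb : b ∈ F), ∀ c, block c = b → (t'.1 c ≠ 0 ↔ c = rep b (φ ⟨b, hb⟩)) := by
          intro φ
          have hrep' : ∃ ρ : Fin m → Fin d, (∀ b, block (ρ b) = b) ∧
              ∀ b (hb : b ∈ F), ρ b = rep b (φ ⟨b, hb⟩) := by
            refine ⟨fun b => if hb : b ∈ F then rep b (φ ⟨b, hb⟩) else rep b ⟨0, hB⟩, ?_, ?_⟩
            · intro b
              dsimp only
              split_ifs <;> exact hrep _ _
            · intro b hb
              simp [hb]
          obtain ⟨ρ, hρ, hρF⟩ := hrep'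
          obtain ⟨t', h1, h2⟩ := exists_term_replace block t F
            (fun b hb => (hmem t b).1 (hfree_sub _ hb)) ρ
          have hst : supp t' = supp t := by
            ext b
            by_cases hb : b ∈ F
            · refine iff_of_true ((hmem t' b).2 ⟨ρ b, hρ b, ?_⟩) (hfree_sub _ hb)
              rw [h2 _ (by rwa [hρ]), hρ]
            · rw [hmem, hmem]
              refine exists_congr fun c => and_congr_right fun hc => ?_
              rw [h1 c (hc ▸ hb)]
          refine ⟨t', ?_, ?_⟩
          · simp only [hkey, hst, Prod.mk.injEq, true_and]
            ext1 c
            split_ifs with hc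
            · rfl
            · exact h1 c hc
          · rintro b hb c rfl
            rw [h2 c hb, hρF _ hb]
        choose R hR1 hR2 using hrepl
        refine hτB.trans ?_
        rw [← hcard, ← Finset.card_univ]
        refine Finset.card_le_card_of_injOn R (fun φ _ => by simpa using hR1 φ) ?_
        intro φ _ φ' _ h
        ext1 ⟨b, hb⟩
        have h1 := (hR2 φ b hb (rep b (φ ⟨b, hb⟩)) (hrep _ _)).2 rfl
        rw [h] at h1
        exact hinj b ((hR2 φ' b hb _ (hrep _ _)).1 h1)
      rw [← Finset.card_univ (α := Term d g), Finset.card_eq_sum_card_image key, ← smul_eq_mul]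
      refine (Finset.card_nsmul_le_sum _ _ _ hclass).trans ?_
      exact Finset.sum_le_sum_of_subset (Finset.filter_subset _ _)
    · refine le_trans ?_ (card_filter_card_lt_le m k hm)
      refine Finset.card_le_card_of_injOn Prod.fst ?_ ?_
      · intro x hx
        have := (Finset.mem_filter.1 hx).2
        simpa using this
      · intro x hx y hy hxy
        -- If fewer than `k` blocks are met, all of them are free; no exponents are recorded, and
        -- the key is determined by the set of blocks.
        have hzero : ∀ x ∈ (Finset.univ.image key).filter (fun x => ¬ k ≤ x.1.card), x.2 = 0 := by
          intro x hx
          obtain ⟨hx, hk⟩ := Finset.mem_filter.1 hx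
          obtain ⟨t, _, rfl⟩ := Finset.mem_image.1 hx
          have hFS : free (supp t) = supp t :=
            Finset.eq_of_subset_of_card_le (hfree_sub _)
              (by rw [hfree_card]; exact (min_eq_right (not_le.1 hk).le).ge)
          ext1 c
          simp only [hkey, hFS, Pi.zero_apply, ite_eq_left_iff]
          intro hc
          by_contra h0
          exact hc ((hmem _ _).2 ⟨c, rfl, h0⟩)
        exact Prod.ext hxy ((hzero x hx).trans (hzero y hy).symm)

/-- The terms of degree at most `g` in `d ≥ g` variables can be partitioned such that each class
involves `O(g)` variables, and almost every class is large. -/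
theorem exists_key {k τ : ℕ} (hk : 0 < k) (hkg : k ≤ g) (hgd : g ≤ d) (hτ : 0 < τ)
    (hτg : τ ≤ (g / k) ^ k) :
    ∃ (m : ℕ) (key : Term d g → Finset (Fin m) × (Fin d → Fin (g + 1))),
      (∀ x, ∃ S : Finset (Fin d), S.card ≤ 3 * g ∧
        ∀ t, key t = x → ∀ c, t.1 c ≠ 0 → c ∈ S) ∧
      (Finset.univ.image key).card ≤ Fintype.card (Term d g) / τ + k * d ^ k := by
  set B := g / k with hB
  have hBpos : 0 < B := Nat.div_pos hkg hk
  have hBd : B ≤ d := (Nat.div_le_self _ _).trans hgd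
  set m := d / B with hm
  have hmpos : 0 < m := Nat.div_pos hBd hBpos
  have hmB : m * B ≤ d := Nat.div_mul_le_self _ _
  have hdm : d < m * (2 * B) := by
    have : d < m * B + B := Nat.lt_div_mul_add hBpos
    nlinarith
  -- The blocks are the residue classes modulo `m`. Since `m * B ≤ d < m * (2 * B)`, each has at
  -- least `B` and at most `2 * B` elements; then `g + k * (2 * B) ≤ 3 * g`.
  obtain ⟨key, h1, h2⟩ := exists_key_of_blocks (g := g) (d := d) (B := B) (β := 2 * B) hmpos hBpos
    (fun c => ⟨c % m, Nat.mod_lt _ hmpos⟩)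
    (fun b x => ⟨b + m * x, by
      have := Nat.mul_le_mul_left m (Nat.succ_le_of_lt x.2)
      have := b.2
      rw [Nat.mul_succ] at *
      omega⟩)
    (by
      intro b x
      ext
      simp [Nat.mod_eq_of_lt b.2])
    (by
      intro b x y h
      simp only [Fin.mk.injEq, Nat.add_left_cancel_iff] at h
      exact Fin.ext (Nat.eq_of_mul_eq_mul_left hmpos h))
    (by
      intro b
      rw [← Finset.card_range (2 * B)]
      refine Finset.card_le_card_of_injOn (fun c => c / m) ?_ ?_
      · intro c _
        simp only [Finset.coe_range, Set.mem_Iio]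
        rw [Nat.div_lt_iff_lt_mul hmpos, mul_comm]
        exact c.2.trans hdm
      · intro c hc c' hc' h
        simp only [Finset.coe_filter, Finset.mem_univ, true_and, Set.mem_ofPred_eq] at hc hc'
        have hmod : (c : ℕ) % m = c' % m := by
          simpa using congrArg Fin.val (hc.trans hc'.symm)
        simp only at h
        ext
        rw [← Nat.div_add_mod (c : ℕ) m, h, hmod, Nat.div_add_mod]) k hτ hτg
  refine ⟨m, key, fun x => ?_, h2.trans ?_⟩
  · obtain ⟨S, hS, hS'⟩ := h1 x
    refine ⟨S, hS.trans ?_, hS'⟩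
    have : B * k ≤ g := Nat.div_mul_le_self _ _
    nlinarith
  · exact Nat.add_le_add_left
      (Nat.mul_le_mul_left _ (Nat.pow_le_pow_left (Nat.div_le_self _ _) _)) _

/-! ### Choice of the block sizes -/

/-- If the terms can be partitioned into few keys each of which involves `O(w)` variables, then the
cost is `O(n r d w / M)`. -/
theorem optimalCost_attentionDAG_le_of_key {n d g M w : ℕ} (hn : 0 < n) (hd : 0 < d) (hg : 0 < g)
    (hw : 0 < w) (hwg : w ≤ g) (hwd : w ≤ d) (hgM : 4 * g ≤ M) (hM : 4 ≤ M) {κ : Type*}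
    [DecidableEq κ] (key : Term d g → κ)
    (hσ : ∀ x, ∃ S : Finset (Fin d), S.card ≤ 3 * w ∧
      ∀ t, key t = x → ∀ c, t.1 c ≠ 0 → c ∈ S)
    (hkey : ((Finset.univ.image key).card : ℝ) ≤ 9 * ((d + g).choose g * w / M)) :
    ((attentionDAG n d g).optimalCost M : ℝ≥0∞) ≤
      ENNReal.ofReal (612 * ((n : ℝ) * ((d + g).choose g : ℝ) * d * g / M)) := by
  set r := (d + g).choose g with hr
  -- Now `τ * w` and `τ` are each at most `M / 4`, and `2 ≤ M / 2`, so a block fits into fast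
  -- memory.
  set τ := M / (4 * w) with hτ
  have hτpos : 0 < τ := Nat.div_pos (by omega) (by omega)
  have hτw : τ * (4 * w) ≤ M := Nat.div_mul_le_self _ _
  obtain ⟨f, hf1, hf2, hf3⟩ := exists_refinement key hτpos
  obtain ⟨f', -, hf2', hf3'⟩ := exists_refinement (fun _ : Option (Fin d) => ()) hw
  have hcost := AttnNode.optimalCost_attentionDAG_le (M := M) hn hd hg f f' (τ := τ) (w := w)
    (σ := 3 * w) hf2 hf2'
    (by
      intro x
      obtain ⟨S, hS, hS'⟩ := hσ x.1
      exact ⟨S, hS, fun t ht => hS' t (by rw [← hf1, ht])⟩)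
    (by nlinarith) (by omega)
  set N := (Finset.univ.image f).card with hN
  set N' := (Finset.univ.image f').card with hN'
  have hNpos : 1 ≤ N := Finset.card_pos.2
    ⟨f ⟨fun _ => 0, by simp⟩, Finset.mem_image_of_mem _ (Finset.mem_univ _)⟩
  -- There are `d + 1` columns, so `N' * w ≤ d + 1 + w`, and both `w` and `1` are at most `d`.
  have hN'w : N' * w ≤ 3 * d := by
    have h1 : N' ≤ (d + 1) / w + 1 := by
      refine hf3'.trans ?_
      rw [Fintype.card_option, Fintype.card_fin]
      exact Nat.add_le_add_left (Finset.card_le_one.2 fun _ _ _ _ => rfl) _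
    have h2 : (d + 1) / w * w ≤ d + 1 := Nat.div_mul_le_self _ _
    nlinarith
  have hMR : (0 : ℝ) < M := by exact_mod_cast (by omega : 0 < M)
  -- The constant is `8 + 9`: the pieces of length `τ ≥ M / (8 * w)`, and one possibly short piece
  -- per key.
  have hNR : (N : ℝ) ≤ 17 * (r * w / M) := by
    have h1 : (N : ℝ) ≤ (r : ℝ) / τ + (Finset.univ.image key).card := by
      have h2 : N ≤ r / τ + (Finset.univ.image key).card :=
        hf3.trans (Nat.add_le_add_right (Nat.div_le_div_right (card_term_le d g)) _)
      refine (Nat.cast_le (α := ℝ).2 h2).trans ?_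
      push_cast
      exact add_le_add Nat.cast_div_le le_rfl
    have h3 : (r : ℝ) / τ ≤ 8 * (r * w / M) := by
      have h4 : M ≤ 8 * w * τ := by
        have : M < M / (4 * w) * (4 * w) + 4 * w := Nat.lt_div_mul_add (by omega)
        rw [← hτ] at this
        nlinarith
      have h4R : (M : ℝ) ≤ 8 * w * τ := by exact_mod_cast h4
      have hτR : (0 : ℝ) < τ := by exact_mod_cast hτpos
      rw [← mul_div_assoc, div_le_div_iff₀ hτR hMR]
      have : (0 : ℝ) ≤ r := Nat.cast_nonneg _
      nlinarith
    linarith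
  -- Here `36 = 11 * 3 + 3`, the final divisions being absorbed since `N ≥ 1`; below, `612 = 36 *
  -- 17`.
  have htotal : N * N' * (n * (2 * (3 * w) + 2 + 3 * w)) + n * d * 3 ≤ 36 * (n * d * N) := by
    have h1 : 2 * (3 * w) + 2 + 3 * w ≤ 11 * w := by omega
    calc N * N' * (n * (2 * (3 * w) + 2 + 3 * w)) + n * d * 3
        ≤ N * N' * (n * (11 * w)) + n * d * 3 * N :=
          add_le_add (Nat.mul_le_mul_left _ (Nat.mul_le_mul_left _ h1))
            (Nat.le_mul_of_pos_right _ hNpos)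
      _ = N * n * 11 * (N' * w) + n * d * 3 * N := by ring
      _ ≤ N * n * 11 * (3 * d) + n * d * 3 * N :=
          Nat.add_le_add_right (Nat.mul_le_mul_left _ hN'w) _
      _ = 36 * (n * d * N) := by ring
  have hfinal : ((36 * (n * d * N) : ℕ) : ℝ) ≤ 612 * ((n : ℝ) * (r : ℝ) * d * g / M) := by
    have hwR : (w : ℝ) ≤ g := by exact_mod_cast hwg
    have hN2 : (N : ℝ) ≤ 17 * (r * g / M) := hNR.trans (by gcongr)
    push_cast
    calc (36 * ((n : ℝ) * d * N)) ≤ 36 * ((n : ℝ) * d * (17 * (r * g / M))) := by gcongr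
      _ = 612 * ((n : ℝ) * (r : ℝ) * d * g / M) := by ring
  calc ((attentionDAG n d g).optimalCost M : ℝ≥0∞)
      ≤ (((36 * (n * d * N) : ℕ) : ℕ∞) : ℝ≥0∞) := by
        refine ENat.toENNReal_le.2 (hcost.trans ?_)
        exact_mod_cast htotal
    _ = ENNReal.ofReal ((36 * (n * d * N) : ℕ) : ℝ) := by
        rw [ENNReal.ofReal_natCast]
        rfl
    _ ≤ _ := ENNReal.ofReal_le_ofReal hfinal

/-- For `d ≤ g` a single key suffices, and `M ≤ d r` makes its count `1` at most `r d / M`. For `d >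
g` the bound `9` is `8 + 1`: large classes contribute `8 r g / M`, and the `k d ^ k` exceptional
keys at most `r g / M`, because `r` is at least the central binomial coefficient of `g`, hence at
least `2 ^ g`. -/
theorem optimalCost_attentionDAG_le_of_bounds {n d g M k : ℕ} (hn : 0 < n) (hd : 0 < d)
    (hg : 0 < g) (hgM : 4 * g ≤ M) (hM : 4 ≤ M) (hMr : M ≤ d * (d + g).choose g) (hk : 0 < k)
    (hkg : k ≤ g) (hMk : M ≤ (g / k) ^ k) (hdM : k * d ^ k * M ≤ 2 ^ g) :
    ((attentionDAG n d g).optimalCost M : ℝ≥0∞) ≤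
      ENNReal.ofReal (612 * ((n : ℝ) * ((d + g).choose g : ℝ) * d * g / M)) := by
  have hMR : (0 : ℝ) < M := by exact_mod_cast (by omega : 0 < M)
  set r := (d + g).choose g with hr
  rcases le_or_gt d g with hdg | hgd
  · refine optimalCost_attentionDAG_le_of_key hn hd hg hd hdg le_rfl hgM hM (fun _ => ()) ?_ ?_
    · exact fun _ => ⟨Finset.univ, by simp; omega, by simp⟩
    · have h1 : (1 : ℝ) ≤ r * d / M := by
        rw [le_div_iff₀ hMR, one_mul, mul_comm]
        exact_mod_cast hMr
      have h2 : ((Finset.univ.image fun _ : Term d g => ()).card : ℝ) ≤ 1 := by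
        exact_mod_cast Finset.card_le_one.2 fun _ _ _ _ => rfl
      linarith
  · set τ := M / (4 * g) with hτ
    have hτpos : 0 < τ := Nat.div_pos (by omega) (by omega)
    obtain ⟨m, key, h1, h2⟩ := exists_key (d := d) hk hkg hgd.le hτpos
      ((Nat.div_le_self _ _).trans hMk)
    refine optimalCost_attentionDAG_le_of_key hn hd hg hg le_rfl hgd.le hgM hM key h1 ?_
    have h3 : ((Finset.univ.image key).card : ℝ) ≤ (r : ℝ) / τ + (k * d ^ k : ℕ) := by
      have h4 : (Finset.univ.image key).card ≤ r / τ + k * d ^ k :=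
        h2.trans (Nat.add_le_add_right (Nat.div_le_div_right (card_term_le d g)) _)
      refine (Nat.cast_le (α := ℝ).2 h4).trans ?_
      rw [Nat.cast_add]
      exact add_le_add Nat.cast_div_le le_rfl
    have h5 : (r : ℝ) / τ ≤ 8 * (r * g / M) := by
      have h4 : M ≤ 8 * g * τ := by
        have : M < M / (4 * g) * (4 * g) + 4 * g := Nat.lt_div_mul_add (by omega)
        rw [← hτ] at this
        nlinarith
      have h4R : (M : ℝ) ≤ 8 * g * τ := by exact_mod_cast h4
      have hτR : (0 : ℝ) < τ := by exact_mod_cast hτpos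
      rw [← mul_div_assoc, div_le_div_iff₀ hτR hMR]
      have : (0 : ℝ) ≤ r := Nat.cast_nonneg _
      nlinarith
    have h6 : ((k * d ^ k : ℕ) : ℝ) ≤ r * g / M := by
      rw [le_div_iff₀ hMR]
      have h7 : 2 ^ g ≤ r := by
        refine (two_pow_le_centralBinom g).trans ?_
        rw [Nat.centralBinom_eq_two_mul_choose]
        exact Nat.choose_le_choose _ (by omega)
      have h8 : k * d ^ k * M ≤ r * g :=
        (hdM.trans h7).trans (Nat.le_mul_of_pos_right _ hg)
      exact_mod_cast h8
    linarith

/-! ### Asymptotics -/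

theorem lemma2 {ι : Type*} (l : Filter ι) (n d g M r : ι → ℕ)
    (hn : ∀ a, 0 < n a) (hd : ∀ a, 0 < d a) (hg : ∀ a, 0 < g a) (hM : ∀ a, 0 < M a)
    (hr : ∀ a, r a = (d a + g a).choose (g a))
    (hMdr : (fun a => (M a : ℝ)) =o[l] fun a => (d a : ℝ) * (r a : ℝ))
    (hlog : (fun a => Real.log (M a : ℝ)) =O[l] fun a => (g a : ℝ))
    (hsqrt : (fun a => (g a : ℝ)) =o[l] fun a => Real.sqrt (M a : ℝ))
    (δ₁ δ₂ : ℝ) (hδ₁ : 0 < δ₁) (hδ₂ : 0 < δ₂)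
    (hdg : (fun a => (d a : ℝ)) =O[l] fun a => (g a : ℝ) ^ (2 - δ₁))
    (hMg : (fun a => (M a : ℝ)) =O[l] fun a => (g a : ℝ) ^ δ₂) :
    ∃ C : ℝ, 0 < C ∧ ∀ᶠ a in l,
      ((attentionDAG (n a) (d a) (g a)).optimalCost (M a) : ℝ≥0∞) ≤
        ENNReal.ofReal
          (C * ((n a : ℝ) * (r a : ℝ) * (d a : ℝ) * (g a : ℝ) / (M a : ℝ))) := by
  have hg1 : ∀ a, (1 : ℝ) ≤ g a := fun a => by exact_mod_cast hg a
  obtain ⟨C₁, hC₁, hd'⟩ := hdg.exists_pos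
  obtain ⟨C₂, hC₂, hM'⟩ := hMg.exists_pos
  have hdle : ∀ᶠ a in l, (d a : ℝ) ≤ C₁ * (g a : ℝ) ^ 2 := by
    filter_upwards [hd'.bound] with a ha
    rw [Real.norm_natCast, Real.norm_of_nonneg (by positivity)] at ha
    refine ha.trans (mul_le_mul_of_nonneg_left ?_ hC₁.le)
    rw [← Real.rpow_natCast]
    exact Real.rpow_le_rpow_of_exponent_le (hg1 a) (by push_cast; linarith)
  have hMle : ∀ᶠ a in l, (M a : ℝ) ≤ C₂ * (g a : ℝ) ^ δ₂ := by
    filter_upwards [hM'.bound] with a ha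
    rwa [Real.norm_natCast, Real.norm_of_nonneg (by positivity)] at ha
  have hsq : ∀ ε : ℝ, 0 < ε → ∀ᶠ a in l, (g a : ℝ) ≤ ε * Real.sqrt (M a) := by
    intro ε hε
    filter_upwards [hsqrt.bound hε] with a ha
    rwa [Real.norm_natCast, Real.norm_of_nonneg (by positivity)] at ha
  -- From `1 ≤ g = o(√M)`; then `g` tends to infinity as well, because `M` is bounded by a power of
  -- `g`.
  have hMtop : Tendsto (fun a => (M a : ℝ)) l atTop := by
    rw [tendsto_atTop]
    intro b
    filter_upwards [hsq (Real.sqrt (|b| + 1))⁻¹ (by positivity)] with a ha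
    have h1 := (hg1 a).trans ha
    have h2 : 0 < Real.sqrt (|b| + 1) := by positivity
    rw [inv_mul_eq_div, le_div_iff₀ h2, one_mul] at h1
    have h3 := (Real.sqrt_le_sqrt_iff (by positivity)).1 h1
    linarith [le_abs_self b]
  have hgtop : Tendsto g l atTop := by
    rw [tendsto_atTop]
    intro b
    filter_upwards [hMle, hMtop.eventually_gt_atTop (C₂ * (b : ℝ) ^ δ₂)] with a h1 h2
    by_contra h
    have h3 : (g a : ℝ) ≤ b := by exact_mod_cast (not_le.1 h).le
    have h4 := Real.rpow_le_rpow (by positivity) h3 hδ₂.le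
    nlinarith
  have hgtopR : Tendsto (fun a => (g a : ℝ)) l atTop :=
    tendsto_natCast_atTop_atTop.comp hgtop
  -- The `+ 1` leaves a spare factor `g` between `g ^ δ₂` and `g ^ k`, which absorbs the constants
  -- `C₂ * (2 * k) ^ k` in the proof of `M ≤ (g / k) ^ k`.
  set k := ⌈δ₂⌉₊ + 1 with hk
  have hkδ : δ₂ + 1 ≤ k := by
    rw [hk]
    push_cast
    linarith [Nat.le_ceil δ₂]
  have hpow : ∀ a, (g a : ℝ) ^ δ₂ * g a ≤ (g a : ℝ) ^ k := by
    intro a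
    rw [← Real.rpow_natCast, ← Real.rpow_add_one (by linarith [hg1 a])]
    exact Real.rpow_le_rpow_of_exponent_le (hg1 a) hkδ
  -- The exponent `3 * k` comes from `d ^ k = O(g ^ (2 * k))` and `M = O(g ^ k)`.
  have hexp : ∀ᶠ a in l, k * C₁ ^ k * C₂ * (g a : ℝ) ^ (3 * k) ≤ 2 ^ g a := by
    have h := (tendsto_pow_const_div_const_pow_of_one_lt (3 * k) (one_lt_two (α := ℝ))).comp hgtop
    have hpos : 0 < (k * C₁ ^ k * C₂)⁻¹ := by positivity
    filter_upwards [h.eventually (gt_mem_nhds hpos)] with a ha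
    simp only [Function.comp_apply] at ha
    rw [div_lt_iff₀ (by positivity), inv_mul_eq_div, lt_div_iff₀ (by positivity)] at ha
    linarith
  refine ⟨612, by norm_num, ?_⟩
  filter_upwards [hdle, hMle, hsq (1 / 2) (by norm_num), hMdr.bound one_pos, hexp,
    hgtop.eventually_ge_atTop k, hgtopR.eventually_ge_atTop (C₂ * (2 * k) ^ k)]
    with a h1 h2 h3 h4 h5 h6 h7
  rw [hr a]
  have hgpos := hg1 a
  have h4g : 4 * g a ^ 2 ≤ M a := by
    have h8 := Real.sq_sqrt (Nat.cast_nonneg (α := ℝ) (M a))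
    have h9 : 4 * (g a : ℝ) ^ 2 ≤ M a := by nlinarith [Real.sqrt_nonneg (M a : ℝ)]
    exact_mod_cast h9
  have hga := hg a
  refine optimalCost_attentionDAG_le_of_bounds (k := k) (hn a) (hd a) hga (by nlinarith)
    (by nlinarith) ?_ (by omega) h6 ?_ ?_
  · rw [Real.norm_natCast, one_mul, Real.norm_of_nonneg (by positivity), hr a] at h4
    exact_mod_cast h4
  -- Rounding down loses at most a factor 2, because `g ≥ k`.
  · have h8 : g a ≤ 2 * k * (g a / k) := by
      have h9 : g a < g a / k * k + k := Nat.lt_div_mul_add (by omega)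
      have h10 : 1 ≤ g a / k := Nat.div_pos h6 (by omega)
      nlinarith
    have h8R : (g a : ℝ) ≤ 2 * k * (g a / k : ℕ) := by exact_mod_cast h8
    have h11 : (M a : ℝ) * (2 * k) ^ k ≤ ((g a / k : ℕ) : ℝ) ^ k * (2 * k) ^ k := by
      calc (M a : ℝ) * (2 * k) ^ k ≤ C₂ * (g a : ℝ) ^ δ₂ * (2 * k) ^ k := by gcongr
        _ = (g a : ℝ) ^ δ₂ * (C₂ * (2 * k) ^ k) := by ring
        _ ≤ (g a : ℝ) ^ δ₂ * g a := by gcongr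
        _ ≤ (g a : ℝ) ^ k := hpow a
        _ ≤ (2 * k * (g a / k : ℕ)) ^ k := by gcongr
        _ = ((g a / k : ℕ) : ℝ) ^ k * (2 * k) ^ k := by rw [mul_pow, mul_comm]
    have h12 := le_of_mul_le_mul_right h11 (by positivity)
    exact_mod_cast h12
  · have h8 : (k : ℝ) * (d a : ℝ) ^ k * M a ≤ 2 ^ g a := by
      calc (k : ℝ) * (d a : ℝ) ^ k * M a
          ≤ k * (C₁ * (g a : ℝ) ^ 2) ^ k * (C₂ * (g a : ℝ) ^ k) := by
            have h9 : (g a : ℝ) ^ δ₂ ≤ (g a : ℝ) ^ k := by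
              refine le_trans ?_ (hpow a)
              exact le_mul_of_one_le_right (by positivity) hgpos
            have h10 : (M a : ℝ) ≤ C₂ * (g a : ℝ) ^ k :=
              h2.trans (mul_le_mul_of_nonneg_left h9 hC₂.le)
            gcongr
        _ = k * C₁ ^ k * C₂ * (g a : ℝ) ^ (3 * k) := by
            rw [mul_pow, ← pow_mul, show 3 * k = 2 * k + k by ring, pow_add]
            ring
        _ ≤ 2 ^ g a := h5
    exact_mod_cast h8
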